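/- Let $n\ge 1$ and let $\mathbb F$ be a field. Let $\mathcal A_n$ be the space of type $A$ rational functions $$F=\frac{L(x_1,\dots,x_n)}{\prod_{1\le i<j\le n}(1-x_j/x_i)^{q_{ij}}},$$ where $L$ is a homogeneous Laurent polynomial of degree $0$ over $\mathbb F$ and the $q_{ij}$ are nonnegative integers. For $i\ne j$ and $F\in\mathcal A_n$ take the partial fraction decomposition of $F$ with respect to $x_i$, $$F=L_1(x_i)+\sum_{u\ne i}\frac{A_u(x_i)}{(1-x_i/x_u)^{q_u}},$$ where $L_1$ is a Laurent polynomial in $x_i$ and $A_u$ is a polynomial in $x_i$ of degree less than $q_u$, with coefficients that are rational functions in the variables other than $x_i$. Put $[i,j]F=A_j(0)$. This defines linear operators $[i,j]:\mathcal A_n\to\mathcal A_n$. Let $\Xi$ be the unital algebra of linear operators on $\mathcal A_n$ generated by all $[i,j]$, $i\neq j$, under composition. A forest $D$ on $\{1,\dots,n\}$ is an ordered rooted forest with vertex set $\{1,\dots,n\}$, whose edges are directed towards the roots ($i\to j$ means that $j$ is the parent of $i$), and in which the children of every vertex are ordered from left to right. It is increasing if $i>j$ for every edge $i\to j$, and nearly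 increasing if $i>j$ for every edge $i\to j$ such that $j$ is not a root. It is augmented if the labels of the children of every vertex increase from left to right. The realization $L(T)$ of a tree $T$ is the composition $[i_1,j_1][i_2,j_2]\cdots[i_s,j_s]$ (the rightmost operator acts first), where $i_1\to j_1,\dots,i_s\to j_s$ are the edges of $T$ read level by level from the root downwards, and from left to right in each level. The realization $L(D)$ of a forest $D$ is the product of the realizations of its trees; their order does not matter. Let $B^0=\{\mathrm{id}\}$. For $1\le s\le n-2$ let $B^s$ be the set of all $L(D)$, where $D$ is an augmented nearly increasing forest on $\{1,\dots,n\}$ with exactly $n-s$ components. For $n\ge 2$ let $B^{n-1}$ be the set of all $L(T)$, where $T$ is an augmented increasing tree on $\{1,\dots,n\}$. Then the union $\bigcup_{s=0}^{n-1}B^s$ is a basis of $\Xi$ as a vector space over $\mathbb F$. -/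

import Mathlib

open Polynomial

noncomputable section

namespace ConstantTermAlgebra

/-! ### Type A rational functions -/

section TypeA

variable (𝕜 : Type*) [Field 𝕜] (n : ℕ)

/-- The field of rational functions `𝕜(x₁, …, xₙ)`. -/
def RatFun : Type _ := FractionRing (MvPolynomial (Fin n) 𝕜)

instance : Field (RatFun 𝕜 n) := inferInstanceAs (Field (FractionRing (MvPolynomial (Fin n) 𝕜)))

instance : Algebra (MvPolynomial (Fin n) 𝕜) (RatFun 𝕜 n) :=
  inferInstanceAs (Algebra _ (FractionRing (MvPolynomial (Fin n) 𝕜)))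

instance : Algebra 𝕜 (RatFun 𝕜 n) :=
  inferInstanceAs (Algebra 𝕜 (FractionRing (MvPolynomial (Fin n) 𝕜)))

instance : IsScalarTower 𝕜 (MvPolynomial (Fin n) 𝕜) (RatFun 𝕜 n) :=
  inferInstanceAs (IsScalarTower 𝕜 _ (FractionRing (MvPolynomial (Fin n) 𝕜)))

instance : IsFractionRing (MvPolynomial (Fin n) 𝕜) (RatFun 𝕜 n) :=
  inferInstanceAs (IsFractionRing _ (FractionRing (MvPolynomial (Fin n) 𝕜)))

variable {n}

/-- The variable `x_i`. -/
def x (i : Fin n) : RatFun 𝕜 n := algebraMap (MvPolynomial (Fin n) 𝕜) _ (MvPolynomial.X i)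

variable (n)

/-- Homogeneous Laurent polynomials of degree `0` in `x₁, …, xₙ`: the linear span of the Laurent
monomials whose exponents sum to `0`. -/
def laurentZero : Submodule 𝕜 (RatFun 𝕜 n) :=
  Submodule.span 𝕜 {M | ∃ a : Fin n → ℤ, ∑ i, a i = 0 ∧ M = ∏ i, x 𝕜 i ^ a i}

variable {n}

/-- The denominator `∏_{i < j} (1 - x_j / x_i) ^ q_{ij}`. -/
def denom (q : Fin n → Fin n → ℕ) : RatFun 𝕜 n :=
  ∏ i, ∏ j ∈ Finset.Ioi i, (1 - x 𝕜 j / x 𝕜 i) ^ q i j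

variable {𝕜}

theorem x_ne_zero (i : Fin n) : x 𝕜 i ≠ 0 := by
  unfold x
  rw [Ne, IsFractionRing.to_map_eq_zero_iff]
  exact MvPolynomial.X_ne_zero i

theorem x_injective : Function.Injective (x 𝕜 : Fin n → RatFun 𝕜 n) := fun _ _ h =>
  MvPolynomial.X_injective (IsFractionRing.injective (MvPolynomial (Fin n) 𝕜) (RatFun 𝕜 n) h)

theorem one_sub_ne_zero {i j : Fin n} (h : i ≠ j) : (1 - x 𝕜 i / x 𝕜 j) ≠ 0 := by
  rw [sub_ne_zero]
  intro h1
  rw [eq_div_iff (x_ne_zero j), one_mul] at h1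
  exact h (x_injective h1.symm)

theorem denom_ne_zero (q : Fin n → Fin n → ℕ) : denom 𝕜 q ≠ 0 :=
  Finset.prod_ne_zero_iff.2 fun _ _ => Finset.prod_ne_zero_iff.2 fun _ hj =>
    pow_ne_zero _ (one_sub_ne_zero (Finset.mem_Ioi.1 hj).ne')

theorem denom_add (q r : Fin n → Fin n → ℕ) : denom 𝕜 (q + r) = denom 𝕜 q * denom 𝕜 r := by
  simp [denom, pow_add, Finset.prod_mul_distrib]

theorem monomial_mem (a : Fin n → ℤ) (ha : ∑ i, a i = 0) :
    (∏ i, x 𝕜 i ^ a i) ∈ laurentZero 𝕜 n :=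
  Submodule.subset_span ⟨a, ha, rfl⟩

theorem prod_zpow_single {K : Type*} [Field K] (f : Fin n → K) (j : Fin n) :
    ∏ k, f k ^ (Pi.single j 1 : Fin n → ℤ) k = f j := by
  rw [Finset.prod_eq_single j]
  · simp
  · intro b _ hb
    simp [hb]
  · simp

theorem prod_zpow_const {K : Type*} [Field K] {c : K} (hc : c ≠ 0) (a : Fin n → ℤ)
    (s : Finset (Fin n)) : ∏ i ∈ s, c ^ a i = c ^ ∑ i ∈ s, a i := by
  induction s using Finset.induction_on with
  | empty => simp
  | insert i s hi ih => rw [Finset.prod_insert hi, Finset.sum_insert hi, zpow_add₀ hc, ih]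

theorem div_mem_laurentZero (i j : Fin n) : x 𝕜 i / x 𝕜 j ∈ laurentZero 𝕜 n := by
  have h := monomial_mem (𝕜 := 𝕜) (Pi.single i 1 - Pi.single j 1 : Fin n → ℤ) (by simp)
  simp_rw [Pi.sub_apply, zpow_sub₀ (x_ne_zero (𝕜 := 𝕜) (n := n) _), Finset.prod_div_distrib,
    prod_zpow_single] at h
  exact h

theorem laurentZero_one : (1 : RatFun 𝕜 n) ∈ laurentZero 𝕜 n := by
  simpa using monomial_mem (𝕜 := 𝕜) (n := n) 0 (by simp)

theorem laurentZero_mul {F G : RatFun 𝕜 n} (hF : F ∈ laurentZero 𝕜 n)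
    (hG : G ∈ laurentZero 𝕜 n) : F * G ∈ laurentZero 𝕜 n := by
  induction hF, hG using Submodule.span_induction₂ with
  | mem_mem F G hF hG =>
    obtain ⟨a, ha, rfl⟩ := hF
    obtain ⟨b, hb, rfl⟩ := hG
    rw [← Finset.prod_mul_distrib]
    simp_rw [← zpow_add₀ (x_ne_zero (𝕜 := 𝕜) (n := n) _)]
    exact monomial_mem (fun i => a i + b i) (by simp [Finset.sum_add_distrib, ha, hb])
  | zero_left G _ => simp
  | zero_right F _ => simp
  | add_left F G H _ _ _ h1 h2 => rw [add_mul]; exact add_mem h1 h2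
  | add_right F G H _ _ _ h1 h2 => rw [mul_add]; exact add_mem h1 h2
  | smul_left r F G _ _ h => rw [smul_mul_assoc]; exact Submodule.smul_mem _ _ h
  | smul_right r F G _ _ h => rw [mul_smul_comm]; exact Submodule.smul_mem _ _ h

theorem denom_mem (q : Fin n → Fin n → ℕ) : denom 𝕜 q ∈ laurentZero 𝕜 n := by
  let S : Subalgebra 𝕜 (RatFun 𝕜 n) :=
    (laurentZero 𝕜 n).toSubalgebra laurentZero_one fun _ _ => laurentZero_mul
  show denom 𝕜 q ∈ S
  exact prod_mem fun i _ => prod_mem fun j _ => pow_mem (sub_mem (one_mem S) (show _ ∈ S from div_mem_laurentZero j i)) _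

variable (𝕜 n)

/-- The space `𝒜ₙ` of type A rational functions `L / ∏_{i < j} (1 - x_j / x_i) ^ q_{ij}`, with `L` a
homogeneous Laurent polynomial of degree `0`. -/
def typeA : Submodule 𝕜 (RatFun 𝕜 n) where
  carrier := {F | ∃ L ∈ laurentZero 𝕜 n, ∃ q : Fin n → Fin n → ℕ, F = L / denom 𝕜 q}
  zero_mem' := ⟨0, zero_mem _, 0, by simp⟩
  add_mem' := by
    rintro _ _ ⟨L, hL, q, rfl⟩ ⟨M, hM, r, rfl⟩
    refine ⟨L * denom 𝕜 r + denom 𝕜 q * M, add_mem (laurentZero_mul hL (denom_mem r))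
      (laurentZero_mul (denom_mem q) hM), q + r, ?_⟩
    rw [denom_add, div_add_div _ _ (denom_ne_zero q) (denom_ne_zero r)]
  smul_mem' := by
    rintro c _ ⟨L, hL, q, rfl⟩
    exact ⟨c • L, Submodule.smul_mem _ _ hL, q, by rw [smul_div_assoc]⟩

variable {𝕜 n}

theorem typeA_of_laurent {F : RatFun 𝕜 n} (h : F ∈ laurentZero 𝕜 n) : F ∈ typeA 𝕜 n :=
  ⟨F, h, 0, by simp [denom]⟩

theorem typeA_mul {F G : RatFun 𝕜 n} (hF : F ∈ typeA 𝕜 n) (hG : G ∈ typeA 𝕜 n) :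
    F * G ∈ typeA 𝕜 n := by
  obtain ⟨L, hL, q, rfl⟩ := hF
  obtain ⟨M, hM, r, rfl⟩ := hG
  exact ⟨L * M, laurentZero_mul hL hM, q + r, by rw [denom_add, div_mul_div_comm]⟩

theorem typeA_div (i j : Fin n) : x 𝕜 i / x 𝕜 j ∈ typeA 𝕜 n :=
  typeA_of_laurent (div_mem_laurentZero i j)

theorem one_sub_swap {i j : Fin n} (h : i ≠ j) :
    (1 - x 𝕜 i / x 𝕜 j)⁻¹ = -(x 𝕜 j / x 𝕜 i) * (1 - x 𝕜 j / x 𝕜 i)⁻¹ := by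
  have h1 := one_sub_ne_zero (𝕜 := 𝕜) h
  have h2 := one_sub_ne_zero (𝕜 := 𝕜) h.symm
  have h3 := x_ne_zero (𝕜 := 𝕜) i
  have h4 := x_ne_zero (𝕜 := 𝕜) j
  rw [inv_eq_iff_eq_inv, mul_inv, inv_inv]
  field_simp
  ring

theorem typeA_inv {i j : Fin n} (h : i ≠ j) : (1 - x 𝕜 i / x 𝕜 j)⁻¹ ∈ typeA 𝕜 n := by
  have key : ∀ i j : Fin n, i < j → (1 - x 𝕜 j / x 𝕜 i)⁻¹ ∈ typeA 𝕜 n := by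
    intro i j hij
    refine ⟨1, laurentZero_one, Pi.single i (Pi.single j 1), ?_⟩
    rw [inv_eq_one_div]
    congr 1
    rw [denom, Finset.prod_eq_single i, Finset.prod_eq_single j]
    · simp
    · intro b _ hb
      simp [hb]
    · intro h
      exact absurd (Finset.mem_Ioi.2 hij) h
    · intro b _ hb
      simp [hb]
    · simp
  rcases lt_or_gt_of_ne h with h1 | h1
  · rw [one_sub_swap h]
    exact typeA_mul (neg_mem (typeA_div _ _)) (key _ _ h1)
  · exact key _ _ h1

/-- `𝒜ₙ` is the smallest algebra that contains all `x_u / x_v` and `1 / (1 - x_u / x_v)`. -/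
theorem typeA_le (S : Subalgebra 𝕜 (RatFun 𝕜 n)) (h1 : ∀ u v, x 𝕜 u / x 𝕜 v ∈ S)
    (h2 : ∀ u v, u ≠ v → (1 - x 𝕜 u / x 𝕜 v)⁻¹ ∈ S) : typeA 𝕜 n ≤ Subalgebra.toSubmodule S := by
  have hz : ∀ (k : ℤ) (u v : Fin n), (x 𝕜 u / x 𝕜 v) ^ k ∈ S := by
    intro k u v
    obtain ⟨m, rfl | rfl⟩ := k.eq_nat_or_neg
    · rw [zpow_natCast]
      exact pow_mem (h1 u v) m
    · rw [zpow_neg, zpow_natCast, ← inv_pow, inv_div]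
      exact pow_mem (h1 v u) m
  rintro _ ⟨L, hL, q, rfl⟩
  rw [div_eq_mul_inv, Subalgebra.mem_toSubmodule]
  refine mul_mem ?_ ?_
  · refine (Submodule.span_le (p := Subalgebra.toSubmodule S)).2 ?_ hL
    rintro _ ⟨a, ha, rfl⟩
    rw [SetLike.mem_coe, Subalgebra.mem_toSubmodule]
    rcases isEmpty_or_nonempty (Fin n) with _ | ⟨⟨j⟩⟩
    · simp
    · have : (∏ i, x 𝕜 i ^ a i) = ∏ i, (x 𝕜 i / x 𝕜 j) ^ a i := by
        simp_rw [div_zpow, Finset.prod_div_distrib]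
        rw [prod_zpow_const (x_ne_zero j), ha]
        simp
      rw [this]
      exact prod_mem fun i _ => hz _ _ _
  · rw [denom, ← Finset.prod_inv_distrib]
    refine prod_mem fun i _ => ?_
    rw [← Finset.prod_inv_distrib]
    refine prod_mem fun j hj => ?_
    rw [← inv_pow]
    exact pow_mem (h2 _ _ (Finset.mem_Ioi.1 hj).ne') _

end TypeA

/-! ### Partial fractions and the constant term operators -/

section ConstantTerm

variable (𝕜 : Type*) [Field 𝕜] {n : ℕ}

/-- The field of rational functions that do not involve `x_i`. -/
def freeOf (i : Fin n) : IntermediateField 𝕜 (RatFun 𝕜 n) :=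
  IntermediateField.adjoin 𝕜 (x 𝕜 '' {u | u ≠ i})

variable {𝕜}

/-- A partial fraction decomposition of `F` with respect to `x_i`:
`F = P(x_i) / x_i ^ m + ∑_{u ≠ i} A_u(x_i) / (1 - x_i / x_u) ^ q_u` with `deg A_u < q_u`. The
coefficients of the polynomials `P` and `A_u` are rational functions in the other variables. The first
summand is an arbitrary Laurent polynomial in `x_i`. -/
def IsPartialFraction (i : Fin n) (F : RatFun 𝕜 n) (m : ℕ) (P : (freeOf 𝕜 i)[X]) (q : Fin n → ℕ)
    (A : Fin n → (freeOf 𝕜 i)[X]) : Prop :=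
  (∀ u, u ≠ i → (A u).degree < q u) ∧
    F = aeval (x 𝕜 i) P / x 𝕜 i ^ m +
      ∑ u ∈ Finset.univ.erase i, aeval (x 𝕜 i) (A u) / (1 - x 𝕜 i / x 𝕜 u) ^ q u

/-- `c` is the constant term of `F` at `x_i = x_j`: in a partial fraction decomposition of `F` with
respect to `x_i`, the numerator `A_j(x_i)` over the power of `1 - x_i / x_j` has the value `c` at
`x_i = 0`. -/
def IsConstantTerm (i j : Fin n) (F c : RatFun 𝕜 n) : Prop :=
  ∃ m P q A, IsPartialFraction i F m P q A ∧ c = ((A j).eval 0 : freeOf 𝕜 i)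

theorem x_mem_freeOf {i u : Fin n} (h : u ≠ i) : x 𝕜 u ∈ freeOf 𝕜 i :=
  IntermediateField.subset_adjoin _ _ ⟨u, h, rfl⟩

open scoped IntermediateField.algebraAdjoinAdjoin in
theorem transcendental_x (i : Fin n) : Transcendental (freeOf 𝕜 i) (x 𝕜 i) := by
  have h : AlgebraicIndependent 𝕜 (x 𝕜 : Fin n → RatFun 𝕜 n) :=
    (MvPolynomial.algebraicIndependent_X (Fin n) 𝕜).map'
      (f := IsScalarTower.toAlgHom 𝕜 (MvPolynomial (Fin n) 𝕜) (RatFun 𝕜 n))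
      (IsFractionRing.injective (MvPolynomial (Fin n) 𝕜) (RatFun 𝕜 n))
  have h2 := h.transcendental_adjoin (s := {u | u ≠ i}) (i := i) (by simp)
  intro h3
  exact h2 ((IsFractionRing.isAlgebraic_iff (Algebra.adjoin 𝕜 (x 𝕜 '' {u | u ≠ i}))
    (IntermediateField.adjoin 𝕜 (x 𝕜 '' {u | u ≠ i})) (RatFun 𝕜 n)).2 h3)

/-- The polynomial `1 - X / x_u` over the rational functions free of `x_i`. -/
def pole (i u : Fin n) : (freeOf 𝕜 i)[X] :=
  if h : u ≠ i then 1 - C (⟨x 𝕜 u, x_mem_freeOf h⟩⁻¹) * X else 1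

theorem aeval_pole {i u : Fin n} (h : u ≠ i) :
    aeval (x 𝕜 i) (pole i u : (freeOf 𝕜 i)[X]) = 1 - x 𝕜 i / x 𝕜 u := by
  rw [pole, dif_pos h]
  simp only [map_sub, map_one, map_mul, aeval_C, aeval_X]
  rw [div_eq_inv_mul]
  rfl

theorem eval_zero_pole (i u : Fin n) : (pole i u : (freeOf 𝕜 i)[X]).eval 0 = 1 := by
  unfold pole
  split_ifs <;> simp

theorem degree_pole {i u : Fin n} (h : u ≠ i) : (pole i u : (freeOf 𝕜 i)[X]).degree = 1 := by
  have hu : (⟨x 𝕜 u, x_mem_freeOf h⟩ : freeOf 𝕜 i)⁻¹ ≠ 0 :=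
    inv_ne_zero fun h0 => x_ne_zero u (congrArg Subtype.val h0)
  rw [pole, dif_pos h, sub_eq_add_neg, add_comm, ← neg_mul, ← C_neg]
  exact degree_linear (neg_ne_zero.2 hu)

theorem pole_coprime {i u v : Fin n} (huv : u ≠ v) :
    IsCoprime (pole i u : (freeOf 𝕜 i)[X]) (pole i v) := by
  by_cases hu : u = i
  · simp [pole, hu, isCoprime_one_left]
  by_cases hv : v = i
  · simp [pole, hv, isCoprime_one_right]
  rw [pole, pole, dif_pos hu, dif_pos hv]
  set a : freeOf 𝕜 i := ⟨x 𝕜 u, x_mem_freeOf hu⟩ with ha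
  set b : freeOf 𝕜 i := ⟨x 𝕜 v, x_mem_freeOf hv⟩ with hb
  have ha0 : a ≠ 0 := fun h0 => x_ne_zero u (congrArg Subtype.val h0)
  have hb0 : b ≠ 0 := fun h0 => x_ne_zero v (congrArg Subtype.val h0)
  have hab : a - b ≠ 0 := sub_ne_zero.2 fun h0 => huv (x_injective (congrArg Subtype.val h0))
  refine ⟨C (a / (a - b)), C (-b / (a - b)), ?_⟩
  have e1 : C (a / (a - b)) * (1 - C a⁻¹ * X) + C (-b / (a - b)) * (1 - C b⁻¹ * X)
      = C (a / (a - b) + -b / (a - b)) - C (a / (a - b) * a⁻¹ + -b / (a - b) * b⁻¹) * X := by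
    simp only [map_add, map_mul]
    ring
  have e2 : a / (a - b) + -b / (a - b) = 1 := by
    field_simp
    ring
  have e3 : a / (a - b) * a⁻¹ + -b / (a - b) * b⁻¹ = 0 := by
    field_simp
    ring
  rw [e1, e2, e3]
  simp

theorem pole_coprime_X (i u : Fin n) : IsCoprime (pole i u : (freeOf 𝕜 i)[X]) X := by
  unfold pole
  split_ifs with h
  · exact ⟨1, C (⟨x 𝕜 u, x_mem_freeOf h⟩⁻¹), by ring⟩
  · exact isCoprime_one_left

theorem pole_ne_zero (i u : Fin n) : (pole i u : (freeOf 𝕜 i)[X]) ≠ 0 := by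
  intro h
  simpa [h] using eval_zero_pole (𝕜 := 𝕜) i u

theorem IsPartialFraction.raise {i : Fin n} {F : RatFun 𝕜 n} {m : ℕ} {P : (freeOf 𝕜 i)[X]}
    {q : Fin n → ℕ} {A : Fin n → (freeOf 𝕜 i)[X]} (h : IsPartialFraction i F m P q A) (k : ℕ)
    (r : Fin n → ℕ) :
    IsPartialFraction i F (m + k) (P * X ^ k) (q + r) (fun u => A u * pole i u ^ r u) := by
  refine ⟨fun u hu => ?_, ?_⟩
  · rw [degree_mul, degree_pow, degree_pole hu]
    simp only [nsmul_eq_mul, mul_one, Pi.add_apply, Nat.cast_add]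
    exact WithBot.add_lt_add_right (WithBot.natCast_ne_bot _) (h.1 u hu)
  · rw [h.2]
    congr 1
    · rw [map_mul, map_pow, aeval_X, pow_add, mul_div_mul_right _ _ (pow_ne_zero _ (x_ne_zero i))]
    · refine Finset.sum_congr rfl fun u hu => ?_
      have hu := Finset.ne_of_mem_erase hu
      rw [map_mul, map_pow, aeval_pole hu, Pi.add_apply, pow_add,
        mul_div_mul_right _ _ (pow_ne_zero _ (one_sub_ne_zero hu.symm))]

theorem IsPartialFraction.add {i : Fin n} {F G : RatFun 𝕜 n} {m : ℕ} {P R : (freeOf 𝕜 i)[X]}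
    {q : Fin n → ℕ} {A B : Fin n → (freeOf 𝕜 i)[X]} (h : IsPartialFraction i F m P q A)
    (h' : IsPartialFraction i G m R q B) :
    IsPartialFraction i (F + G) m (P + R) q (fun u => A u + B u) := by
  refine ⟨fun u hu => (degree_add_le _ _).trans_lt (max_lt (h.1 u hu) (h'.1 u hu)), ?_⟩
  rw [h.2, h'.2]
  simp only [map_add, add_div, Finset.sum_add_distrib]
  ring

theorem IsPartialFraction.smul {i : Fin n} {F : RatFun 𝕜 n} {m : ℕ} {P : (freeOf 𝕜 i)[X]}
    {q : Fin n → ℕ} {A : Fin n → (freeOf 𝕜 i)[X]} (h : IsPartialFraction i F m P q A)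
    (c : freeOf 𝕜 i) :
    IsPartialFraction i ((c : RatFun 𝕜 n) * F) m (C c * P) q (fun u => C c * A u) := by
  refine ⟨fun u hu => lt_of_le_of_lt ?_ (h.1 u hu), ?_⟩
  · simpa only [← smul_eq_C_mul] using degree_smul_le c (A u)
  · rw [h.2]
    simp only [map_mul, aeval_C, mul_add, Finset.mul_sum, mul_div_assoc]
    rfl

theorem IsConstantTerm.add {i j : Fin n} {F G c d : RatFun 𝕜 n} (h : IsConstantTerm i j F c)
    (h' : IsConstantTerm i j G d) : IsConstantTerm i j (F + G) (c + d) := by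
  obtain ⟨m, P, q, A, hF, rfl⟩ := h
  obtain ⟨k, R, r, B, hG, rfl⟩ := h'
  have hG' := hG.raise m q
  rw [add_comm k m, add_comm r q] at hG'
  refine ⟨_, _, _, _, (hF.raise k r).add hG', ?_⟩
  simp [eval_zero_pole]

theorem IsConstantTerm.mul {i j : Fin n} {F c : RatFun 𝕜 n} (h : IsConstantTerm i j F c)
    {a : RatFun 𝕜 n} (ha : a ∈ freeOf 𝕜 i) : IsConstantTerm i j (a * F) (a * c) := by
  obtain ⟨m, P, q, A, hF, rfl⟩ := h
  exact ⟨_, _, _, _, hF.smul ⟨a, ha⟩, by simp⟩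

theorem dvd_of_partialFraction_eq_zero {K E ι : Type*} [Field K] [Field E] [Algebra K E]
    [DecidableEq ι] {t : E} (ht : Transcendental K t) {s : Finset ι} {j : ι} (hj : j ∈ s) (m : ℕ)
    (P : K[X]) (A g : ι → K[X]) (hX : IsCoprime (g j) X)
    (hcop : ∀ u ∈ s.erase j, IsCoprime (g j) (g u)) (hg : ∀ u, g u ≠ 0)
    (h : 0 = aeval t P / t ^ m + ∑ u ∈ s, aeval t (A u) / aeval t (g u)) : g j ∣ A j := by
  have inj := transcendental_iff_injective.1 ht
  have hg' : ∀ u, aeval t (g u) ≠ 0 := fun u => by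
    rw [Ne, ← map_zero (aeval (R := K) t), inj.eq_iff]
    exact hg u
  have ht0 : t ^ m ≠ 0 := by
    refine pow_ne_zero _ fun h0 => ht ?_
    rw [h0]
    exact isAlgebraic_zero
  have hc : IsCoprime (g j) (X ^ m * ∏ u ∈ s.erase j, g u) :=
    IsCoprime.mul_right hX.pow_right (IsCoprime.prod_right hcop)
  refine hc.dvd_of_dvd_mul_left ⟨-(P * ∏ u ∈ s.erase j, g u + ∑ u ∈ s.erase j,
    A u * X ^ m * ∏ v ∈ (s.erase j).erase u, g v), ?_⟩
  apply inj
  rw [← Finset.add_sum_erase _ _ hj] at h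
  have hE : aeval t (P * ∏ u ∈ s.erase j, g u + ∑ u ∈ s.erase j,
      A u * X ^ m * ∏ v ∈ (s.erase j).erase u, g v) = aeval t (∏ u ∈ s.erase j, g u) * t ^ m *
        (aeval t P / t ^ m + ∑ u ∈ s.erase j, aeval t (A u) / aeval t (g u)) := by
    rw [mul_add, map_add, map_mul, map_sum, Finset.mul_sum]
    congr 1
    · rw [mul_assoc, mul_div_cancel₀ _ ht0, mul_comm]
    · refine Finset.sum_congr rfl fun u hu => ?_
      rw [← Finset.mul_prod_erase _ _ hu, map_mul, map_mul, map_mul, map_pow, aeval_X]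
      have := hg' u
      field_simp
  have h2 : (aeval t P / t ^ m + ∑ u ∈ s.erase j, aeval t (A u) / aeval t (g u)) =
      -(aeval t (A j) / aeval t (g j)) := by
    rw [eq_neg_iff_add_eq_zero, h]
    ring
  rw [map_mul (aeval t) (g j), map_neg, hE, h2, map_mul, map_mul, map_pow, aeval_X]
  have := hg' j
  field_simp

theorem IsConstantTerm.eq_zero {i j : Fin n} (hij : i ≠ j) {c : RatFun 𝕜 n}
    (h : IsConstantTerm i j 0 c) : c = 0 := by
  obtain ⟨m, P, q, A, ⟨hdeg, h⟩, rfl⟩ := h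
  suffices A j = 0 by simp [this]
  have hj : j ∈ Finset.univ.erase i := Finset.mem_erase.2 ⟨hij.symm, Finset.mem_univ _⟩
  have h3 : pole i j ^ q j ∣ A j := by
    refine dvd_of_partialFraction_eq_zero (transcendental_x (𝕜 := 𝕜) i) hj m P A
      (fun u => pole i u ^ q u) (pole_coprime_X i j).pow_left
      (fun u hu => (pole_coprime (Finset.ne_of_mem_erase hu).symm).pow)
      (fun u => pow_ne_zero _ (pole_ne_zero i u)) ?_
    rw [h]
    congr 1
    refine Finset.sum_congr rfl fun u hu => ?_
    rw [map_pow, aeval_pole (Finset.ne_of_mem_erase hu)]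
  by_contra h0
  have h4 := degree_le_of_dvd h3 h0
  rw [degree_pow, degree_pole hij.symm, nsmul_eq_mul, mul_one] at h4
  exact absurd (hdeg j hij.symm) (not_lt.2 h4)

theorem IsConstantTerm.unique {i j : Fin n} (hij : i ≠ j) {F c d : RatFun 𝕜 n}
    (h : IsConstantTerm i j F c) (h' : IsConstantTerm i j F d) : c = d := by
  have h1 := h.add (h'.mul (neg_mem (one_mem (freeOf 𝕜 i))))
  rw [neg_one_mul, neg_one_mul, add_neg_cancel] at h1
  have h2 := h1.eq_zero hij
  rwa [add_neg_eq_zero] at h2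

theorem IsConstantTerm.zpow {i j k : Fin n} (hk : k ≠ i) (e : ℤ) :
    IsConstantTerm i j ((x 𝕜 i / x 𝕜 k) ^ e) 0 := by
  obtain ⟨m, rfl | rfl⟩ := e.eq_nat_or_neg
  · refine ⟨0, C (⟨x 𝕜 k, x_mem_freeOf hk⟩⁻¹ ^ m) * X ^ m, 0, 0, ⟨fun u _ => ?_, ?_⟩, by simp⟩
    · simp
    · simp only [Pi.zero_apply, map_zero, Finset.sum_const_zero, add_zero, pow_zero,
        div_one, map_mul, map_pow, aeval_C, aeval_X, zpow_natCast]
      rw [div_eq_inv_mul, mul_pow]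
      rfl
  · refine ⟨m, C ((⟨x 𝕜 k, x_mem_freeOf hk⟩ : freeOf 𝕜 i) ^ m), 0, 0, ⟨fun u _ => ?_, ?_⟩, by simp⟩
    · simp
    · simp only [Pi.zero_apply, map_zero, zero_div, Finset.sum_const_zero, add_zero,
        map_pow, aeval_C, zpow_neg, zpow_natCast]
      rw [← inv_pow, inv_div, div_pow]
      rfl

theorem IsConstantTerm.inv_pow {i j u : Fin n} (hu : u ≠ i) (k : ℕ) :
    IsConstantTerm i j ((1 - x 𝕜 i / x 𝕜 u)⁻¹ ^ (k + 1)) (if j = u then 1 else 0) := by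
  refine ⟨0, 0, Pi.single u (k + 1), Pi.single u 1, ⟨fun v _ => ?_, ?_⟩, ?_⟩
  · by_cases hv : v = u
    · subst hv
      simp only [Pi.single_eq_same, degree_one]
      exact_mod_cast Nat.succ_pos k
    · simp [hv]
  · rw [Finset.sum_eq_single u]
    · simp [div_eq_mul_inv]
    · intro v _ hv
      simp [hv]
    · intro h
      exact absurd (Finset.mem_erase.2 ⟨hu, Finset.mem_univ _⟩) h
  · by_cases hj : j = u
    · subst hj
      simp
    · simp [hj]

/-- Type A rational functions that do not involve `x_i`. -/
def typeAFree (𝕜 : Type*) [Field 𝕜] {n : ℕ} (i : Fin n) : Set (RatFun 𝕜 n) :=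
  {c | c ∈ typeA 𝕜 n ∧ c ∈ freeOf 𝕜 i}

theorem typeAFree_mul {i : Fin n} {c d : RatFun 𝕜 n} (hc : c ∈ typeAFree 𝕜 i)
    (hd : d ∈ typeAFree 𝕜 i) : c * d ∈ typeAFree 𝕜 i :=
  ⟨typeA_mul hc.1 hd.1, mul_mem hc.2 hd.2⟩

theorem typeAFree_one {i : Fin n} : (1 : RatFun 𝕜 n) ∈ typeAFree 𝕜 i :=
  ⟨typeA_of_laurent laurentZero_one, one_mem _⟩

theorem typeAFree_div {i u v : Fin n} (hu : u ≠ i) (hv : v ≠ i) :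
    x 𝕜 u / x 𝕜 v ∈ typeAFree 𝕜 i :=
  ⟨typeA_div _ _, div_mem (x_mem_freeOf hu) (x_mem_freeOf hv)⟩

theorem typeAFree_inv {i u v : Fin n} (hu : u ≠ i) (hv : v ≠ i) (huv : u ≠ v) :
    (1 - x 𝕜 u / x 𝕜 v)⁻¹ ∈ typeAFree 𝕜 i :=
  ⟨typeA_inv huv, inv_mem (sub_mem (one_mem _) (typeAFree_div hu hv).2)⟩

/-- The summands of partial fraction decompositions of type A rational functions. -/
def summands (𝕜 : Type*) [Field 𝕜] {n : ℕ} (i j : Fin n) : Set (RatFun 𝕜 n) :=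
  {F | ∃ c ∈ typeAFree 𝕜 i, (∃ k : ℤ, F = c * (x 𝕜 i / x 𝕜 j) ^ k) ∨
    ∃ u, u ≠ i ∧ ∃ k : ℕ, F = c * (1 - x 𝕜 i / x 𝕜 u)⁻¹ ^ k}

theorem summands_zpow {i j : Fin n} {c : RatFun 𝕜 n} (hc : c ∈ typeAFree 𝕜 i) (k : ℤ) :
    c * (x 𝕜 i / x 𝕜 j) ^ k ∈ Submodule.span 𝕜 (summands 𝕜 i j) :=
  Submodule.subset_span ⟨c, hc, Or.inl ⟨k, rfl⟩⟩

theorem summands_inv {i j u : Fin n} (hu : u ≠ i) {c : RatFun 𝕜 n} (hc : c ∈ typeAFree 𝕜 i)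
    (k : ℕ) : c * (1 - x 𝕜 i / x 𝕜 u)⁻¹ ^ k ∈ Submodule.span 𝕜 (summands 𝕜 i j) :=
  Submodule.subset_span ⟨c, hc, Or.inr ⟨u, hu, k, rfl⟩⟩

/-- The multipliers that preserve the span of the summands. -/
def multipliers (𝕜 : Type*) [Field 𝕜] {n : ℕ} (i j : Fin n) : Subalgebra 𝕜 (RatFun 𝕜 n) where
  carrier := {g | ∀ F ∈ Submodule.span 𝕜 (summands 𝕜 i j),
    g * F ∈ Submodule.span 𝕜 (summands 𝕜 i j)}
  mul_mem' := fun {a b} ha hb F hF => by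
    rw [mul_assoc]
    exact ha _ (hb _ hF)
  add_mem' := fun {a b} ha hb F hF => by
    rw [add_mul]
    exact add_mem (ha _ hF) (hb _ hF)
  algebraMap_mem' := fun r F hF => by
    rw [← Algebra.smul_def]
    exact Submodule.smul_mem _ _ hF

theorem mem_multipliers {i j : Fin n} {g : RatFun 𝕜 n}
    (h1 : ∀ c ∈ typeAFree 𝕜 i, ∀ k : ℤ,
      g * (c * (x 𝕜 i / x 𝕜 j) ^ k) ∈ Submodule.span 𝕜 (summands 𝕜 i j))
    (h2 : ∀ c ∈ typeAFree 𝕜 i, ∀ u, u ≠ i → ∀ k : ℕ,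
      g * (c * (1 - x 𝕜 i / x 𝕜 u)⁻¹ ^ k) ∈ Submodule.span 𝕜 (summands 𝕜 i j)) :
    g ∈ multipliers 𝕜 i j := by
  intro F hF
  induction hF using Submodule.span_induction with
  | mem F hF =>
    obtain ⟨c, hc, ⟨k, rfl⟩ | ⟨u, hu, k, rfl⟩⟩ := hF
    · exact h1 c hc k
    · exact h2 c hc u hu k
  | zero => simp
  | add F G _ _ hF hG => rw [mul_add]; exact add_mem hF hG
  | smul r F _ hF => rw [mul_smul_comm]; exact Submodule.smul_mem _ _ hF

theorem free_mem_multipliers {i j : Fin n} {g : RatFun 𝕜 n} (hg : g ∈ typeAFree 𝕜 i) :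
    g ∈ multipliers 𝕜 i j := by
  refine mem_multipliers (fun c hc k => ?_) fun c hc u hu k => ?_
  · rw [← mul_assoc]
    exact summands_zpow (typeAFree_mul hg hc) k
  · rw [← mul_assoc]
    exact summands_inv hu (typeAFree_mul hg hc) k

theorem div_mem_multipliers {i j : Fin n} (hij : i ≠ j) :
    x 𝕜 i / x 𝕜 j ∈ multipliers 𝕜 i j := by
  refine mem_multipliers (fun c hc k => ?_) fun c hc u hu k => ?_
  · rw [mul_left_comm, ← zpow_one_add₀ (div_ne_zero (x_ne_zero i) (x_ne_zero j))]
    exact summands_zpow hc _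
  · cases k with
    | zero => simpa [mul_comm] using summands_zpow (j := j) hc 1
    | succ k =>
      have e : x 𝕜 i / x 𝕜 j * (c * (1 - x 𝕜 i / x 𝕜 u)⁻¹ ^ (k + 1)) =
          x 𝕜 u / x 𝕜 j * c * (1 - x 𝕜 i / x 𝕜 u)⁻¹ ^ (k + 1) -
          x 𝕜 u / x 𝕜 j * c * (1 - x 𝕜 i / x 𝕜 u)⁻¹ ^ k := by
        have h1 := one_sub_ne_zero (𝕜 := 𝕜) hu.symm
        have h2 : x 𝕜 i / x 𝕜 j = x 𝕜 u / x 𝕜 j * (1 - (1 - x 𝕜 i / x 𝕜 u)) := by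
          have := x_ne_zero (𝕜 := 𝕜) u
          have := x_ne_zero (𝕜 := 𝕜) j
          field_simp
          ring
        rw [h2, pow_succ]
        generalize 1 - x 𝕜 i / x 𝕜 u = p at h1
        field_simp
      rw [e]
      have h3 := typeAFree_mul (typeAFree_div (𝕜 := 𝕜) hu hij.symm) hc
      exact sub_mem (summands_inv hu h3 _) (summands_inv hu h3 _)

theorem inv_div_mem_multipliers {i j : Fin n} (hij : i ≠ j) :
    (x 𝕜 i / x 𝕜 j)⁻¹ ∈ multipliers 𝕜 i j := by
  refine mem_multipliers (fun c hc k => ?_) fun c hc u hu k => ?_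
  · have h0 : x 𝕜 i / x 𝕜 j ≠ 0 := div_ne_zero (x_ne_zero i) (x_ne_zero j)
    rw [mul_left_comm, ← zpow_neg_one, ← zpow_add₀ h0]
    exact summands_zpow hc _
  · induction k with
    | zero => simpa [mul_comm] using summands_zpow (j := j) hc (-1)
    | succ k ih =>
      have e : (x 𝕜 i / x 𝕜 j)⁻¹ * (c * (1 - x 𝕜 i / x 𝕜 u)⁻¹ ^ (k + 1)) =
          (x 𝕜 i / x 𝕜 j)⁻¹ * (c * (1 - x 𝕜 i / x 𝕜 u)⁻¹ ^ k) +
          x 𝕜 j / x 𝕜 u * c * (1 - x 𝕜 i / x 𝕜 u)⁻¹ ^ (k + 1) := by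
        have h1 := one_sub_ne_zero (𝕜 := 𝕜) hu.symm
        have h2 : x 𝕜 j / x 𝕜 u = (x 𝕜 i / x 𝕜 j)⁻¹ * (1 - (1 - x 𝕜 i / x 𝕜 u)) := by
          have := x_ne_zero (𝕜 := 𝕜) u
          have := x_ne_zero (𝕜 := 𝕜) j
          have := x_ne_zero (𝕜 := 𝕜) i
          field_simp
          ring
        rw [h2, pow_succ]
        generalize (x 𝕜 i / x 𝕜 j)⁻¹ = y
        generalize 1 - x 𝕜 i / x 𝕜 u = p at h1
        field_simp
        ring
      rw [e]
      exact add_mem ih (summands_inv hu (typeAFree_mul (typeAFree_div hij.symm hu) hc) _)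

theorem inv_mul_inv_eq {K : Type*} [Field K] {a b c : K} (hb : b ≠ 0) (hc : c ≠ 0) (hab : a ≠ b)
    (hac : a ≠ c) (hbc : b ≠ c) : (1 - a / c)⁻¹ * (1 - a / b)⁻¹ =
      (1 - b / c)⁻¹ * (1 - a / b)⁻¹ + (1 - c / b)⁻¹ * (1 - a / c)⁻¹ := by
  have h1 : b - a ≠ 0 := sub_ne_zero.2 hab.symm
  have h2 : c - a ≠ 0 := sub_ne_zero.2 hac.symm
  have h3 : c - b ≠ 0 := sub_ne_zero.2 hbc.symm
  have h4 : b - c ≠ 0 := sub_ne_zero.2 hbc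
  have e : b - c = -(c - b) := by ring
  rw [one_sub_div hc, one_sub_div hb, one_sub_div hc, one_sub_div hb, inv_div, inv_div, inv_div,
    inv_div, e]
  field_simp
  ring

theorem one_sub_mem_multipliers {i j v : Fin n} (hij : i ≠ j) (hv : v ≠ i) :
    (1 - x 𝕜 i / x 𝕜 v)⁻¹ ∈ multipliers 𝕜 i j := by
  refine mem_multipliers (fun c hc k => ?_) fun c hc u hu k => ?_
  · have hk : (x 𝕜 i / x 𝕜 j) ^ k ∈ multipliers 𝕜 i j := by
      obtain ⟨m, rfl | rfl⟩ := k.eq_nat_or_neg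
      · rw [zpow_natCast]
        exact pow_mem (div_mem_multipliers hij) m
      · rw [zpow_neg, zpow_natCast, ← _root_.inv_pow]
        exact pow_mem (inv_div_mem_multipliers hij) m
    have h := mul_mem (free_mem_multipliers (j := j) hc) hk _
      (summands_inv (j := j) hv typeAFree_one 1)
    rwa [one_mul, pow_one, mul_comm] at h
  · by_cases huv : u = v
    · subst huv
      rw [mul_left_comm, ← pow_succ']
      exact summands_inv hu hc _
    · induction k with
      | zero => simpa [mul_comm] using summands_inv (j := j) hv hc 1
      | succ k ih =>
        have e : (1 - x 𝕜 i / x 𝕜 v)⁻¹ * (c * (1 - x 𝕜 i / x 𝕜 u)⁻¹ ^ (k + 1)) =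
            (1 - x 𝕜 u / x 𝕜 v)⁻¹ * c * (1 - x 𝕜 i / x 𝕜 u)⁻¹ ^ (k + 1) +
            (1 - x 𝕜 v / x 𝕜 u)⁻¹ *
              ((1 - x 𝕜 i / x 𝕜 v)⁻¹ * (c * (1 - x 𝕜 i / x 𝕜 u)⁻¹ ^ k)) := by
          have h : (1 - x 𝕜 i / x 𝕜 v)⁻¹ * (1 - x 𝕜 i / x 𝕜 u)⁻¹ =
              (1 - x 𝕜 u / x 𝕜 v)⁻¹ * (1 - x 𝕜 i / x 𝕜 u)⁻¹ +
              (1 - x 𝕜 v / x 𝕜 u)⁻¹ * (1 - x 𝕜 i / x 𝕜 v)⁻¹ := by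
            exact inv_mul_inv_eq (x_ne_zero u) (x_ne_zero v) (x_injective.ne hu.symm)
              (x_injective.ne hv.symm) (x_injective.ne huv)
          calc _ = c * (1 - x 𝕜 i / x 𝕜 u)⁻¹ ^ k *
                ((1 - x 𝕜 i / x 𝕜 v)⁻¹ * (1 - x 𝕜 i / x 𝕜 u)⁻¹) := by ring
            _ = _ := by rw [h]; ring
        rw [e]
        exact add_mem (summands_inv hu (typeAFree_mul (typeAFree_inv hu hv huv) hc) _)
          (free_mem_multipliers (typeAFree_inv hv hu (Ne.symm huv)) _ ih)

theorem typeA_le_summands {i j : Fin n} (hij : i ≠ j) :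
    typeA 𝕜 n ≤ Submodule.span 𝕜 (summands 𝕜 i j) := by
  have h : typeA 𝕜 n ≤ Subalgebra.toSubmodule (multipliers 𝕜 i j) := by
    have hd : ∀ u v, x 𝕜 u / x 𝕜 v ∈ multipliers 𝕜 i j := by
      have key : ∀ u v, x 𝕜 u / x 𝕜 v = (x 𝕜 u / x 𝕜 j) * (x 𝕜 j / x 𝕜 v) := fun u v => by
        rw [div_mul_div_cancel₀ (x_ne_zero j)]
      intro u v
      rw [key]
      refine mul_mem ?_ ?_
      · by_cases hu : u = i
        · rw [hu]
          exact div_mem_multipliers hij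
        · exact free_mem_multipliers (typeAFree_div hu hij.symm)
      · by_cases hv : v = i
        · rw [hv, ← inv_div]
          exact inv_div_mem_multipliers hij
        · exact free_mem_multipliers (typeAFree_div hij.symm hv)
    refine typeA_le _ hd fun u v huv => ?_
    by_cases hu : u = i
    · subst hu
      exact one_sub_mem_multipliers hij huv.symm
    · by_cases hv : v = i
      · subst hv
        rw [one_sub_swap huv]
        exact mul_mem (neg_mem (hd _ _)) (one_sub_mem_multipliers hij huv)
      · exact free_mem_multipliers (typeAFree_inv hu hv huv)
  intro F hF
  have h1 := h hF 1 (by simpa using summands_zpow (j := j) (typeAFree_one (𝕜 := 𝕜) (i := i)) 0)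
  rwa [mul_one] at h1

/-- A type A rational function has a constant term at `x_i = x_j`, and it is of type A and free
of `x_i`. -/
theorem exists_constantTerm {i j : Fin n} (hij : i ≠ j) {F : RatFun 𝕜 n} (hF : F ∈ typeA 𝕜 n) :
    ∃ c ∈ typeAFree 𝕜 i, IsConstantTerm i j F c := by
  have hzero : (0 : RatFun 𝕜 n) ∈ typeAFree 𝕜 i := ⟨zero_mem _, zero_mem _⟩
  have hspan := typeA_le_summands hij hF
  clear hF
  induction hspan using Submodule.span_induction with
  | mem F hF =>
    obtain ⟨c, hc, ⟨k, rfl⟩ | ⟨u, hu, k, rfl⟩⟩ := hF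
    · refine ⟨0, hzero, ?_⟩
      simpa using (IsConstantTerm.zpow (𝕜 := 𝕜) (j := j) hij.symm k).mul hc.2
    · cases k with
      | zero =>
        refine ⟨0, hzero, ?_⟩
        simpa using (IsConstantTerm.zpow (𝕜 := 𝕜) (j := j) hij.symm 0).mul hc.2
      | succ k =>
        have h := (IsConstantTerm.inv_pow (𝕜 := 𝕜) (j := j) hu k).mul hc.2
        refine ⟨_, ?_, h⟩
        split_ifs
        · rwa [mul_one]
        · rwa [mul_zero]
  | zero =>
    refine ⟨0, hzero, ?_⟩
    have h := (IsConstantTerm.zpow (𝕜 := 𝕜) (j := j) hij.symm 0).mul (zero_mem (freeOf 𝕜 i))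
    rwa [zero_mul, zero_mul] at h
  | add F G _ _ hF hG =>
    obtain ⟨c, hc, hF⟩ := hF
    obtain ⟨d, hd, hG⟩ := hG
    exact ⟨c + d, ⟨add_mem hc.1 hd.1, add_mem hc.2 hd.2⟩, hF.add hG⟩
  | smul r F _ hF =>
    obtain ⟨c, hc, hF⟩ := hF
    have hr := (freeOf 𝕜 i).algebraMap_mem r
    refine ⟨r • c, ⟨Submodule.smul_mem _ _ hc.1, ?_⟩, ?_⟩
    · rw [Algebra.smul_def]
      exact mul_mem hr hc.2
    · rw [Algebra.smul_def, Algebra.smul_def]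
      exact hF.mul hr

/-- The operator `[i, j] = CT_{x_i = x_j}` on `𝒜ₙ`, for `i ≠ j`. -/
def constantTerm (i j : Fin n) (hij : i ≠ j) : Module.End 𝕜 (typeA 𝕜 n) where
  toFun F := ⟨(exists_constantTerm hij F.2).choose, (exists_constantTerm hij F.2).choose_spec.1.1⟩
  map_add' F G := Subtype.ext <| IsConstantTerm.unique hij
    (exists_constantTerm hij (F + G).2).choose_spec.2
    ((exists_constantTerm hij F.2).choose_spec.2.add (exists_constantTerm hij G.2).choose_spec.2)
  map_smul' r F := Subtype.ext <| IsConstantTerm.unique hij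
    (exists_constantTerm hij (r • F).2).choose_spec.2 <| by
      have h := (exists_constantTerm hij F.2).choose_spec.2.mul ((freeOf 𝕜 i).algebraMap_mem r)
      rw [← Algebra.smul_def, ← Algebra.smul_def] at h
      exact h

theorem constantTerm_spec {i j : Fin n} (hij : i ≠ j) (F : typeA 𝕜 n) :
    IsConstantTerm i j (F : RatFun 𝕜 n) (constantTerm i j hij F : typeA 𝕜 n) :=
  (exists_constantTerm hij F.2).choose_spec.2

variable (𝕜 n)

/-- The constant term algebra `Ξ` of type A: the (unital) algebra of linear operators on `𝒜ₙ` that is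
generated by all `[i, j]`, where multiplication is composition. -/
def constantTermAlgebra : Subalgebra 𝕜 (Module.End 𝕜 (typeA 𝕜 n)) :=
  Algebra.adjoin 𝕜 {T | ∃ i j, ∃ hij : i ≠ j, T = constantTerm i j hij}

variable {n}

/-- The operator `[i, j]` without the proof that `i ≠ j` (the value at `i = j` is irrelevant). -/
def bracket (i j : Fin n) : Module.End 𝕜 (typeA 𝕜 n) :=
  if hij : i ≠ j then constantTerm i j hij else 0

end ConstantTerm

/-! ### Ordered rooted forests and their realizations -/

/-- An ordered directed rooted forest with vertex set `{1, …, n}`. An edge `u → v` is directed from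
the child `u` to its parent `v`, and the children of every vertex are listed from left to right. -/
structure OrderedForest (n : ℕ) where
  children : Fin n → List (Fin n)
  nodup_children : ∀ v, (children v).Nodup
  parent_unique : ∀ u v w, u ∈ children v → u ∈ children w → v = w
  acyclic : ∀ v, ¬ Relation.TransGen (fun u w => u ∈ children w) v v

namespace OrderedForest

variable {n : ℕ} (D : OrderedForest n)

/-- A root is a vertex without a parent. -/
def IsRoot (v : Fin n) : Prop := ∀ w, v ∉ D.children w

instance : DecidablePred D.IsRoot := fun v => inferInstanceAs (Decidable (∀ w, v ∉ D.children w))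

/-- The underlying undirected graph. -/
def graph : SimpleGraph (Fin n) := SimpleGraph.fromRel fun u v => u ∈ D.children v

/-- The number of connected components. -/
def numComponents : ℕ := Nat.card D.graph.ConnectedComponent

/-- All edges `u → v` satisfy `u > v`. -/
def IsIncreasing : Prop := ∀ u v, u ∈ D.children v → v < u

/-- All edges `u → v` that do not end at a root satisfy `u > v`. -/
def IsNearlyIncreasing : Prop := ∀ u v, u ∈ D.children v → ¬ D.IsRoot v → v < u

/-- The children of every vertex have increasing labels from left to right. -/
def IsAugmented : Prop := ∀ v, (D.children v).Pairwise (· < ·)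

/-- The vertices at distance `k` below the vertex `r`, from left to right. -/
def level (r : Fin n) : ℕ → List (Fin n)
  | 0 => [r]
  | k + 1 => (level r k).flatMap D.children

/-- The edges `(i, j)`, meaning `i → j`, of the tree below `r`, read level by level from top to bottom
and from left to right. (The depth of a tree is less than `n`.) -/
def edgeWord (r : Fin n) : List (Fin n × Fin n) :=
  (List.range n).flatMap fun k => (D.level r k).flatMap fun v => (D.children v).map fun u => (u, v)

variable (𝕜 : Type*) [Field 𝕜]

/-- The realization of the tree with root `r`: the product of the `[i, j]` over its edges `i → j`, in
the reading order. The rightmost factor acts first. -/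
def treeRealization (r : Fin n) : Module.End 𝕜 (typeA 𝕜 n) :=
  ((D.edgeWord r).map fun e => bracket 𝕜 e.1 e.2).prod

/-- The realization `L(D)` of a forest: the product of the realizations of its trees. -/
def realization : Module.End 𝕜 (typeA 𝕜 n) :=
  (((List.finRange n).filter D.IsRoot).map (D.treeRealization 𝕜)).prod

end OrderedForest

/-- The set `B^s`. -/
def basisPart (𝕜 : Type*) [Field 𝕜] (n s : ℕ) : Set (Module.End 𝕜 (typeA 𝕜 n)) :=
  if s = 0 then {LinearMap.id}
  else if s + 1 = n then
    {T | ∃ D : OrderedForest n,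
      D.IsAugmented ∧ D.IsIncreasing ∧ D.numComponents = 1 ∧ T = D.realization 𝕜}
  else
    {T | ∃ D : OrderedForest n,
      D.IsAugmented ∧ D.IsNearlyIncreasing ∧ D.numComponents + s = n ∧ T = D.realization 𝕜}

end ConstantTermAlgebra

end

/-! The operator `[i, j]` removes the variable `x_i`, and it kills every type A function written in
a set of variables that misses `x_i` or `x_j`. Partial fractions in two variables then give all the
relations that are needed: `[i, j][k, l] = 0` if `k = i` or `k = j` (`wordProd_eq_zero`); `[i, j][k,
l] = [k, l][i, j]` if `{i, j}` and `{k, l}` are disjoint (`bracket_comm`); `[i, k][j, i] = [j, k][i,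
k] - [i, k][j, k]` for distinct `i, j, k` (`bracket_mul_bracket`), so that `[i, k][j, i]` is
antisymmetric in `i` and `j`; `[i, j] = -[j, i]` on functions of `x_i` and `x_j` alone (`ct_swap`).

Spanning. The relations let an operator be inserted into a word whose sources (first indices)
increase, so such words span. A nonzero one of them is the edge list of a nearly increasing forest,
since an edge into a source further to the right gives `0`. In length `n - 1` a source `0` can be
removed: the other operators leave only two variables, where `ct_swap` turns `[0, j]` into `-[j,
0]`. What remains are the basic words (`span_isBasicWord`).

Independence. For a fixed set of sources, forest words are dual to the products of the `1 / (1 - x_i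
/ x_j)` over their edges (`wordProd_wordFun`). Composition with a further word, which collapses all
remaining variables to one, kills every other basic word that is at least as long. Hence the system
is triangular with respect to length (`exists_dual_functional`).

Forests. Level order and the order by increasing sources differ only by commutations, so the
realization of an augmented forest is the product along its sorted edge list, and every forest word
arises in this way (`basisPart_eq`). -/

noncomputable section

namespace ConstantTermAlgebra

/-! ### Type A rational functions in a subset of the variables -/

section Subsets

variable {𝕜 : Type*} [Field 𝕜] {n : ℕ}

variable (𝕜) in
/-- The algebra of type A rational functions in the variables `x_u`, `u ∈ S`. -/
def typeAOn (S : Set (Fin n)) : Subalgebra 𝕜 (RatFun 𝕜 n) :=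
  Algebra.adjoin 𝕜 {F | ∃ u ∈ S, ∃ v ∈ S,
    F = x 𝕜 u / x 𝕜 v ∨ u ≠ v ∧ F = (1 - x 𝕜 u / x 𝕜 v)⁻¹}

variable {S T : Set (Fin n)} {i j : Fin n}

theorem typeAOn_div {u v : Fin n} (hu : u ∈ S) (hv : v ∈ S) : x 𝕜 u / x 𝕜 v ∈ typeAOn 𝕜 S :=
  Algebra.subset_adjoin ⟨u, hu, v, hv, Or.inl rfl⟩

theorem typeAOn_inv {u v : Fin n} (hu : u ∈ S) (hv : v ∈ S) (huv : u ≠ v) :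
    (1 - x 𝕜 u / x 𝕜 v)⁻¹ ∈ typeAOn 𝕜 S :=
  Algebra.subset_adjoin ⟨u, hu, v, hv, Or.inr ⟨huv, rfl⟩⟩

theorem typeAOn_zpow {u v : Fin n} (hu : u ∈ S) (hv : v ∈ S) (k : ℤ) :
    (x 𝕜 u / x 𝕜 v) ^ k ∈ typeAOn 𝕜 S := by
  obtain ⟨m, rfl | rfl⟩ := k.eq_nat_or_neg
  · rw [zpow_natCast]
    exact pow_mem (typeAOn_div hu hv) m
  · rw [zpow_neg, zpow_natCast, ← inv_pow, inv_div]
    exact pow_mem (typeAOn_div hv hu) m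

theorem typeAOn_mono (h : S ⊆ T) : typeAOn 𝕜 S ≤ typeAOn 𝕜 T := by
  refine Algebra.adjoin_mono ?_
  rintro F ⟨u, hu, v, hv, hF⟩
  exact ⟨u, h hu, v, h hv, hF⟩

theorem mem_freeOf_of_typeAOn {F : RatFun 𝕜 n} (hF : F ∈ typeAOn 𝕜 S) (hi : i ∉ S) :
    F ∈ freeOf 𝕜 i := by
  have h : typeAOn 𝕜 S ≤ (freeOf 𝕜 i).toSubalgebra := by
    refine Algebra.adjoin_le ?_
    have hx : ∀ u ∈ S, x 𝕜 u ∈ freeOf 𝕜 i := fun u hu =>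
      x_mem_freeOf fun h => hi (h ▸ hu)
    rintro F ⟨u, hu, v, hv, rfl | ⟨-, rfl⟩⟩
    · exact (div_mem (hx u hu) (hx v hv) : _ ∈ freeOf 𝕜 i)
    · exact (inv_mem (sub_mem (one_mem _) (div_mem (hx u hu) (hx v hv))) : _ ∈ freeOf 𝕜 i)
  exact h hF

theorem mem_freeOf_of_typeAOn_sdiff {F : RatFun 𝕜 n} (hF : F ∈ typeAOn 𝕜 (S \ {i})) :
    F ∈ freeOf 𝕜 i :=
  mem_freeOf_of_typeAOn hF (by simp)

theorem typeAOn_le_typeA {F : RatFun 𝕜 n} (hF : F ∈ typeAOn 𝕜 S) : F ∈ typeA 𝕜 n := by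
  have h : typeAOn 𝕜 S ≤ (typeA 𝕜 n).toSubalgebra (typeA_of_laurent laurentZero_one)
      fun _ _ => typeA_mul := by
    refine Algebra.adjoin_le ?_
    rintro F ⟨u, -, v, -, rfl | ⟨huv, rfl⟩⟩
    · exact typeA_div u v
    · exact typeA_inv huv
  exact h hF

theorem mem_typeAOn_univ {F : RatFun 𝕜 n} (hF : F ∈ typeA 𝕜 n) : F ∈ typeAOn 𝕜 Set.univ :=
  typeA_le (typeAOn 𝕜 Set.univ) (fun _ _ => typeAOn_div (Set.mem_univ _) (Set.mem_univ _))
    (fun _ _ => typeAOn_inv (Set.mem_univ _) (Set.mem_univ _)) hF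

/-- Degree `0` leaves only constants in a single variable: every generator is `x_u / x_u = 1`. -/
theorem typeAOn_le_bot (hS : S.Subsingleton) : typeAOn 𝕜 S ≤ ⊥ := by
  refine Algebra.adjoin_le ?_
  rintro F ⟨u, hu, v, hv, rfl | ⟨huv, -⟩⟩
  · rw [hS hu hv, div_self (x_ne_zero v)]
    exact one_mem (⊥ : Subalgebra 𝕜 _)
  · exact absurd (hS hu hv) huv

variable (𝕜) in
/-- The summands of partial fraction decompositions of elements of `typeAOn 𝕜 S`. -/
def summandsOn (S : Set (Fin n)) (i j : Fin n) : Set (RatFun 𝕜 n) :=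
  {F | ∃ c ∈ typeAOn 𝕜 (S \ {i}), (∃ k : ℤ, F = c * (x 𝕜 i / x 𝕜 j) ^ k) ∨
    ∃ u ∈ S \ {i}, ∃ k : ℕ, F = c * (1 - x 𝕜 i / x 𝕜 u)⁻¹ ^ (k + 1)}

theorem summandsOn_zpow {c : RatFun 𝕜 n} (hc : c ∈ typeAOn 𝕜 (S \ {i})) (k : ℤ) :
    c * (x 𝕜 i / x 𝕜 j) ^ k ∈ Submodule.span 𝕜 (summandsOn 𝕜 S i j) :=
  Submodule.subset_span ⟨c, hc, Or.inl ⟨k, rfl⟩⟩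

theorem summandsOn_inv {u : Fin n} (hu : u ∈ S \ {i}) {c : RatFun 𝕜 n}
    (hc : c ∈ typeAOn 𝕜 (S \ {i})) (k : ℕ) :
    c * (1 - x 𝕜 i / x 𝕜 u)⁻¹ ^ k ∈ Submodule.span 𝕜 (summandsOn 𝕜 S i j) := by
  cases k with
  | zero => simpa using summandsOn_zpow (j := j) hc 0
  | succ k => exact Submodule.subset_span ⟨c, hc, Or.inr ⟨u, hu, k, rfl⟩⟩

/-- The elements of an algebra that map a subspace to itself by multiplication. -/
def multiplierAlgebra {B : Type*} [CommRing B] [Algebra 𝕜 B] (M : Submodule 𝕜 B) :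
    Subalgebra 𝕜 B where
  carrier := {g | ∀ F ∈ M, g * F ∈ M}
  mul_mem' := fun {a b} ha hb F hF => by
    rw [mul_assoc]
    exact ha _ (hb _ hF)
  add_mem' := fun {a b} ha hb F hF => by
    rw [add_mul]
    exact add_mem (ha _ hF) (hb _ hF)
  algebraMap_mem' := fun r F hF => by
    rw [← Algebra.smul_def]
    exact Submodule.smul_mem _ _ hF

variable (𝕜) in
/-- The multipliers of the span of the summands. -/
abbrev multipliersOn (S : Set (Fin n)) (i j : Fin n) : Subalgebra 𝕜 (RatFun 𝕜 n) :=
  multiplierAlgebra (Submodule.span 𝕜 (summandsOn 𝕜 S i j))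

theorem mem_multipliersOn {g : RatFun 𝕜 n}
    (h1 : ∀ c ∈ typeAOn 𝕜 (S \ {i}), ∀ k : ℤ,
      g * (c * (x 𝕜 i / x 𝕜 j) ^ k) ∈ Submodule.span 𝕜 (summandsOn 𝕜 S i j))
    (h2 : ∀ c ∈ typeAOn 𝕜 (S \ {i}), ∀ u ∈ S \ {i}, ∀ k : ℕ,
      g * (c * (1 - x 𝕜 i / x 𝕜 u)⁻¹ ^ k) ∈ Submodule.span 𝕜 (summandsOn 𝕜 S i j)) :
    g ∈ multipliersOn 𝕜 S i j := by
  intro F hF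
  induction hF using Submodule.span_induction with
  | mem F hF =>
    obtain ⟨c, hc, ⟨k, rfl⟩ | ⟨u, hu, k, rfl⟩⟩ := hF
    · exact h1 c hc k
    · exact h2 c hc u hu _
  | zero => simp
  | add F G _ _ hF hG => rw [mul_add]; exact add_mem hF hG
  | smul r F _ hF => rw [mul_smul_comm]; exact Submodule.smul_mem _ _ hF

theorem free_mem_multipliersOn {g : RatFun 𝕜 n} (hg : g ∈ typeAOn 𝕜 (S \ {i})) :
    g ∈ multipliersOn 𝕜 S i j := by
  refine mem_multipliersOn (fun c hc k => ?_) fun c hc u hu k => ?_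
  · rw [← mul_assoc]
    exact summandsOn_zpow (mul_mem hg hc) k
  · rw [← mul_assoc]
    exact summandsOn_inv hu (mul_mem hg hc) k

theorem div_mem_multipliersOn (hj : j ∈ S \ {i}) : x 𝕜 i / x 𝕜 j ∈ multipliersOn 𝕜 S i j := by
  refine mem_multipliersOn (fun c hc k => ?_) fun c hc u hu k => ?_
  · rw [mul_left_comm, ← zpow_one_add₀ (div_ne_zero (x_ne_zero i) (x_ne_zero j))]
    exact summandsOn_zpow hc _
  · cases k with
    | zero => simpa [mul_comm] using summandsOn_zpow (j := j) hc 1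
    | succ k =>
      have e : x 𝕜 i / x 𝕜 j * (c * (1 - x 𝕜 i / x 𝕜 u)⁻¹ ^ (k + 1)) =
          x 𝕜 u / x 𝕜 j * c * (1 - x 𝕜 i / x 𝕜 u)⁻¹ ^ (k + 1) -
          x 𝕜 u / x 𝕜 j * c * (1 - x 𝕜 i / x 𝕜 u)⁻¹ ^ k := by
        have h1 := one_sub_ne_zero (𝕜 := 𝕜) (Ne.symm hu.2)
        have h2 : x 𝕜 i / x 𝕜 j = x 𝕜 u / x 𝕜 j * (1 - (1 - x 𝕜 i / x 𝕜 u)) := by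
          have := x_ne_zero (𝕜 := 𝕜) u
          have := x_ne_zero (𝕜 := 𝕜) j
          field_simp
          ring
        rw [h2, pow_succ]
        generalize 1 - x 𝕜 i / x 𝕜 u = p at h1
        field_simp
      rw [e]
      have h3 := mul_mem (typeAOn_div (𝕜 := 𝕜) hu hj) hc
      exact sub_mem (summandsOn_inv hu h3 _) (summandsOn_inv hu h3 _)

theorem inv_div_mem_multipliersOn (hj : j ∈ S \ {i}) :
    (x 𝕜 i / x 𝕜 j)⁻¹ ∈ multipliersOn 𝕜 S i j := by
  refine mem_multipliersOn (fun c hc k => ?_) fun c hc u hu k => ?_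
  · have h0 : x 𝕜 i / x 𝕜 j ≠ 0 := div_ne_zero (x_ne_zero i) (x_ne_zero j)
    rw [mul_left_comm, ← zpow_neg_one, ← zpow_add₀ h0]
    exact summandsOn_zpow hc _
  · induction k with
    | zero => simpa [mul_comm] using summandsOn_zpow (j := j) hc (-1)
    | succ k ih =>
      have e : (x 𝕜 i / x 𝕜 j)⁻¹ * (c * (1 - x 𝕜 i / x 𝕜 u)⁻¹ ^ (k + 1)) =
          (x 𝕜 i / x 𝕜 j)⁻¹ * (c * (1 - x 𝕜 i / x 𝕜 u)⁻¹ ^ k) +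
          x 𝕜 j / x 𝕜 u * c * (1 - x 𝕜 i / x 𝕜 u)⁻¹ ^ (k + 1) := by
        have h1 := one_sub_ne_zero (𝕜 := 𝕜) (Ne.symm hu.2)
        have h2 : x 𝕜 j / x 𝕜 u = (x 𝕜 i / x 𝕜 j)⁻¹ * (1 - (1 - x 𝕜 i / x 𝕜 u)) := by
          have := x_ne_zero (𝕜 := 𝕜) u
          have := x_ne_zero (𝕜 := 𝕜) j
          have := x_ne_zero (𝕜 := 𝕜) i
          field_simp
          ring
        rw [h2, pow_succ]
        generalize (x 𝕜 i / x 𝕜 j)⁻¹ = y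
        generalize 1 - x 𝕜 i / x 𝕜 u = p at h1
        field_simp
        ring
      rw [e]
      exact add_mem ih (summandsOn_inv hu (mul_mem (typeAOn_div hj hu) hc) _)

theorem zpow_mem_multipliersOn (hj : j ∈ S \ {i}) (k : ℤ) :
    (x 𝕜 i / x 𝕜 j) ^ k ∈ multipliersOn 𝕜 S i j := by
  obtain ⟨m, rfl | rfl⟩ := k.eq_nat_or_neg
  · rw [zpow_natCast]
    exact pow_mem (div_mem_multipliersOn hj) m
  · rw [zpow_neg, zpow_natCast, ← _root_.inv_pow]
    exact pow_mem (inv_div_mem_multipliersOn hj) m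

/-- Poles at different `x_u` and `x_v` are separated by `inv_mul_inv_eq`, one power at a time. The
coefficients that appear do not involve `x_i`. -/
theorem one_sub_mem_multipliersOn (hj : j ∈ S \ {i}) {v : Fin n} (hv : v ∈ S \ {i}) :
    (1 - x 𝕜 i / x 𝕜 v)⁻¹ ∈ multipliersOn 𝕜 S i j := by
  refine mem_multipliersOn (fun c hc k => ?_) fun c hc u hu k => ?_
  · have h := mul_mem (free_mem_multipliersOn (j := j) hc) (zpow_mem_multipliersOn hj k) _
      (summandsOn_inv (j := j) hv (one_mem _) 1)
    rwa [one_mul, pow_one, mul_comm] at h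
  · by_cases huv : u = v
    · subst huv
      rw [mul_left_comm, ← pow_succ']
      exact summandsOn_inv hu hc _
    · induction k with
      | zero => simpa [mul_comm] using summandsOn_inv (j := j) hv hc 1
      | succ k ih =>
        have e : (1 - x 𝕜 i / x 𝕜 v)⁻¹ * (c * (1 - x 𝕜 i / x 𝕜 u)⁻¹ ^ (k + 1)) =
            (1 - x 𝕜 u / x 𝕜 v)⁻¹ * c * (1 - x 𝕜 i / x 𝕜 u)⁻¹ ^ (k + 1) +
            (1 - x 𝕜 v / x 𝕜 u)⁻¹ *
              ((1 - x 𝕜 i / x 𝕜 v)⁻¹ * (c * (1 - x 𝕜 i / x 𝕜 u)⁻¹ ^ k)) := by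
          have h : (1 - x 𝕜 i / x 𝕜 v)⁻¹ * (1 - x 𝕜 i / x 𝕜 u)⁻¹ =
              (1 - x 𝕜 u / x 𝕜 v)⁻¹ * (1 - x 𝕜 i / x 𝕜 u)⁻¹ +
              (1 - x 𝕜 v / x 𝕜 u)⁻¹ * (1 - x 𝕜 i / x 𝕜 v)⁻¹ :=
            inv_mul_inv_eq (x_ne_zero u) (x_ne_zero v) (x_injective.ne (Ne.symm hu.2))
              (x_injective.ne (Ne.symm hv.2)) (x_injective.ne huv)
          calc _ = c * (1 - x 𝕜 i / x 𝕜 u)⁻¹ ^ k *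
                ((1 - x 𝕜 i / x 𝕜 v)⁻¹ * (1 - x 𝕜 i / x 𝕜 u)⁻¹) := by ring
            _ = _ := by rw [h]; ring
        rw [e]
        exact add_mem (summandsOn_inv hu (mul_mem (typeAOn_inv hu hv huv) hc) _)
          (free_mem_multipliersOn (typeAOn_inv hv hu (Ne.symm huv)) _ ih)

/-- Partial fractions without leaving the variables of `S`. The span contains `1`, and the
generators of `typeAOn 𝕜 S` map it to itself. -/
theorem typeAOn_le_span_summandsOn (hj : j ∈ S \ {i}) {F : RatFun 𝕜 n} (hF : F ∈ typeAOn 𝕜 S) :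
    F ∈ Submodule.span 𝕜 (summandsOn 𝕜 S i j) := by
  have h : typeAOn 𝕜 S ≤ multipliersOn 𝕜 S i j := by
    have hd : ∀ u ∈ S, ∀ v ∈ S, x 𝕜 u / x 𝕜 v ∈ multipliersOn 𝕜 S i j := by
      intro u hu v hv
      rw [← div_mul_div_cancel₀ (x_ne_zero (𝕜 := 𝕜) j)]
      refine mul_mem ?_ ?_
      · by_cases hui : u = i
        · rw [hui]
          exact div_mem_multipliersOn hj
        · exact free_mem_multipliersOn (typeAOn_div ⟨hu, hui⟩ hj)
      · by_cases hvi : v = i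
        · rw [hvi, ← inv_div]
          exact inv_div_mem_multipliersOn hj
        · exact free_mem_multipliersOn (typeAOn_div hj ⟨hv, hvi⟩)
    refine Algebra.adjoin_le ?_
    rintro F ⟨u, hu, v, hv, rfl | ⟨huv, rfl⟩⟩
    · exact hd u hu v hv
    · by_cases hui : u = i
      · subst hui
        exact one_sub_mem_multipliersOn hj ⟨hv, huv.symm⟩
      · by_cases hvi : v = i
        · subst hvi
          rw [one_sub_swap huv]
          exact mul_mem (neg_mem (hd _ hv _ hu)) (one_sub_mem_multipliersOn hj ⟨hu, huv⟩)
        · exact free_mem_multipliersOn (typeAOn_inv ⟨hu, hui⟩ ⟨hv, hvi⟩ huv)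
  have h1 := h hF 1 (by simpa using summandsOn_zpow (j := j) (one_mem (typeAOn 𝕜 (S \ {i}))) 0)
  rwa [mul_one] at h1

/-! ### Constant terms as a function -/

variable (𝕜) in
/-- The constant term of a rational function at `x_i = x_j`, and `0` if there is none. -/
def ct (i j : Fin n) (F : RatFun 𝕜 n) : RatFun 𝕜 n :=
  open Classical in if h : ∃ c, IsConstantTerm i j F c then h.choose else 0

theorem IsConstantTerm.ct_eq (hij : i ≠ j) {F c : RatFun 𝕜 n} (h : IsConstantTerm i j F c) :
    ct 𝕜 i j F = c := by
  have h' : ∃ c, IsConstantTerm i j F c := ⟨c, h⟩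
  rw [ct, dif_pos h']
  exact IsConstantTerm.unique hij h'.choose_spec h

theorem coe_bracket (hij : i ≠ j) (F : typeA 𝕜 n) :
    (bracket 𝕜 i j F : RatFun 𝕜 n) = ct 𝕜 i j F := by
  rw [bracket, dif_pos hij]
  exact (IsConstantTerm.ct_eq hij (constantTerm_spec hij F)).symm

theorem IsConstantTerm.of_freeOf (hij : i ≠ j) {F : RatFun 𝕜 n} (hF : F ∈ freeOf 𝕜 i) :
    IsConstantTerm i j F 0 := by
  simpa using (IsConstantTerm.zpow (𝕜 := 𝕜) (j := j) hij.symm 0).mul hF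

theorem IsConstantTerm.smul {F c : RatFun 𝕜 n} (h : IsConstantTerm i j F c) (r : 𝕜) :
    IsConstantTerm i j (r • F) (r • c) := by
  rw [Algebra.smul_def, Algebra.smul_def]
  exact h.mul ((freeOf 𝕜 i).algebraMap_mem r)

/-- Among the summands only `c / (1 - x_i / x_j) ^ k` with `k ≥ 1` contributes, and it contributes
`c`. The poles that occur are at `x_u` with `u ∈ S`, so nothing is found when `j ∉ S`. -/
theorem exists_isConstantTerm_typeAOn (hij : i ≠ j) {F : RatFun 𝕜 n} (hF : F ∈ typeAOn 𝕜 S) :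
    ∃ c ∈ typeAOn 𝕜 (S \ {i}), IsConstantTerm i j F c ∧ (i ∉ S ∨ j ∉ S → c = 0) := by
  by_cases hi : i ∈ S
  swap
  · exact ⟨0, zero_mem _, .of_freeOf hij (mem_freeOf_of_typeAOn hF hi), fun _ => rfl⟩
  -- The expansion needs a second variable `x_l` to normalize the powers of `x_i`; if there is none,
  -- then `F` is a constant.
  rcases (S \ {i}).eq_empty_or_nonempty with he | ⟨l, hl⟩
  · have hS : S.Subsingleton := Set.subsingleton_of_subset_singleton (Set.sdiff_eq_empty.1 he)
    obtain ⟨r, rfl⟩ := Algebra.mem_bot.1 (typeAOn_le_bot hS hF)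
    exact ⟨0, zero_mem _, .of_freeOf hij ((freeOf 𝕜 i).algebraMap_mem r), fun _ => rfl⟩
  have hspan := typeAOn_le_span_summandsOn hl hF
  clear hF
  induction hspan using Submodule.span_induction with
  | mem F hF =>
    obtain ⟨c, hc, ⟨k, rfl⟩ | ⟨u, hu, k, rfl⟩⟩ := hF
    · refine ⟨0, zero_mem _, ?_, fun _ => rfl⟩
      simpa using (IsConstantTerm.zpow (𝕜 := 𝕜) (j := j) hl.2 k).mul
        (mem_freeOf_of_typeAOn_sdiff hc)
    · have h := (IsConstantTerm.inv_pow (𝕜 := 𝕜) (j := j) hu.2 k).mul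
        (mem_freeOf_of_typeAOn_sdiff hc)
      refine ⟨_, ?_, h, fun h => ?_⟩
      · split_ifs
        · rwa [mul_one]
        · rw [mul_zero]
          exact zero_mem _
      · have hju : j ≠ u := fun hju => h.elim (fun h => h hi) (fun h => h (hju ▸ hu.1))
        rw [if_neg hju, mul_zero]
  | zero => exact ⟨0, zero_mem _, .of_freeOf hij (zero_mem _), fun _ => rfl⟩
  | add F G _ _ hF hG =>
    obtain ⟨c, hc, hF, hc0⟩ := hF
    obtain ⟨d, hd, hG, hd0⟩ := hG
    exact ⟨c + d, add_mem hc hd, hF.add hG, fun h => by rw [hc0 h, hd0 h, add_zero]⟩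
  | smul r F _ hF =>
    obtain ⟨c, hc, hF, hc0⟩ := hF
    exact ⟨r • c, Subalgebra.smul_mem _ hc r, hF.smul r, fun h => by rw [hc0 h, smul_zero]⟩

theorem ct_mem_typeAOn (hij : i ≠ j) {F : RatFun 𝕜 n} (hF : F ∈ typeAOn 𝕜 S) :
    ct 𝕜 i j F ∈ typeAOn 𝕜 (S \ {i}) := by
  obtain ⟨c, hc, h, -⟩ := exists_isConstantTerm_typeAOn hij hF
  rwa [h.ct_eq hij]

theorem isConstantTerm_ct (hij : i ≠ j) {F : RatFun 𝕜 n} (hF : F ∈ typeA 𝕜 n) :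
    IsConstantTerm i j F (ct 𝕜 i j F) := by
  obtain ⟨c, -, h⟩ := exists_constantTerm hij hF
  rwa [h.ct_eq hij]

theorem ct_eq_zero_of_typeAOn (hij : i ≠ j) {F : RatFun 𝕜 n} (hF : F ∈ typeAOn 𝕜 S)
    (h : i ∉ S ∨ j ∉ S) : ct 𝕜 i j F = 0 := by
  obtain ⟨c, -, h1, h0⟩ := exists_isConstantTerm_typeAOn hij hF
  rw [h1.ct_eq hij, h0 h]

theorem ct_mul (hij : i ≠ j) {c F : RatFun 𝕜 n} (hc : c ∈ freeOf 𝕜 i) (hF : F ∈ typeA 𝕜 n) :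
    ct 𝕜 i j (c * F) = c * ct 𝕜 i j F :=
  ((isConstantTerm_ct hij hF).mul hc).ct_eq hij

theorem bracket_self (i : Fin n) : bracket 𝕜 i i = 0 := by simp [bracket]

theorem bracket_mem_typeAOn {F : typeA 𝕜 n} (hF : (F : RatFun 𝕜 n) ∈ typeAOn 𝕜 S) :
    (bracket 𝕜 i j F : RatFun 𝕜 n) ∈ typeAOn 𝕜 (S \ {i}) := by
  by_cases hij : i = j
  · subst hij
    simp [bracket_self]
  · rw [coe_bracket hij]
    exact ct_mem_typeAOn hij hF

theorem bracket_eq_zero_of_typeAOn {F : typeA 𝕜 n} (hF : (F : RatFun 𝕜 n) ∈ typeAOn 𝕜 S)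
    (h : i ∉ S ∨ j ∉ S) : bracket 𝕜 i j F = 0 := by
  by_cases hij : i = j
  · subst hij
    simp [bracket_self]
  · refine Subtype.ext ?_
    rw [coe_bracket hij]
    exact ct_eq_zero_of_typeAOn hij hF h

end Subsets

/-! ### Relations between the operators -/

section Relations

variable {𝕜 : Type*} [Field 𝕜] {n : ℕ} {S : Set (Fin n)} {i j k l : Fin n}

/-- A power of `x_i / x_r`, or a negative power of some `1 - x_i / x_u`. -/
def IsFactor (S : Set (Fin n)) (i r : Fin n) (F : RatFun 𝕜 n) : Prop :=
  (∃ k : ℤ, F = (x 𝕜 i / x 𝕜 r) ^ k) ∨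
    ∃ u ∈ S \ {i}, ∃ k : ℕ, F = (1 - x 𝕜 i / x 𝕜 u)⁻¹ ^ (k + 1)

theorem IsFactor.mem_typeAOn {r : Fin n} {F : RatFun 𝕜 n} (h : IsFactor S i r F) (hi : i ∈ S)
    (hr : r ∈ S) : F ∈ typeAOn 𝕜 S := by
  obtain ⟨k, rfl⟩ | ⟨u, hu, k, rfl⟩ := h
  · exact typeAOn_zpow hi hr k
  · exact pow_mem (typeAOn_inv hi hu.1 (Ne.symm hu.2)) _

theorem IsFactor.exists_isConstantTerm {r : Fin n} {F : RatFun 𝕜 n} (h : IsFactor S i r F)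
    (hr : r ≠ i) (j : Fin n) : ∃ e : 𝕜, IsConstantTerm i j F (algebraMap 𝕜 _ e) := by
  obtain ⟨k, rfl⟩ | ⟨u, hu, k, rfl⟩ := h
  · exact ⟨0, by simpa using IsConstantTerm.zpow hr k⟩
  · refine ⟨if j = u then 1 else 0, ?_⟩
    convert IsConstantTerm.inv_pow (𝕜 := 𝕜) (j := j) hu.2 k
    split_ifs <;> simp

/-- Operators on `𝒜ₙ` agree if they agree on products of partial fractions in two variables. -/
theorem end_ext {a b r : Fin n} (hra : r ≠ a) (hrb : r ≠ b) {T T' : Module.End 𝕜 (typeA 𝕜 n)}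
    (h : ∀ d ∈ typeAOn 𝕜 ((Set.univ \ {a}) \ {b}), ∀ f g : RatFun 𝕜 n,
      IsFactor (Set.univ \ {a}) b r f → IsFactor Set.univ a r g →
      ∀ F : typeA 𝕜 n, (F : RatFun 𝕜 n) = d * f * g → T F = T' F) : T = T' := by
  let N : Submodule 𝕜 (RatFun 𝕜 n) := (LinearMap.eqLocus T T').map (typeA 𝕜 n).subtype
  have hN : typeA 𝕜 n ≤ N := by
    intro F hF
    -- Expand in `x_a`, then expand the coefficients in `x_b`. The variable `x_r` normalizes the
    -- powers in both expansions, so it must differ from both.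
    have h1 := typeAOn_le_span_summandsOn (i := a) (j := r) (S := Set.univ) ⟨Set.mem_univ _, hra⟩
      (mem_typeAOn_univ hF)
    refine Submodule.span_le.2 ?_ h1
    intro F hF
    obtain ⟨c, hc, g, hg, rfl⟩ : ∃ c ∈ typeAOn 𝕜 (Set.univ \ {a}),
        ∃ g, IsFactor Set.univ a r g ∧ F = c * g := by
      obtain ⟨c, hc, ⟨k, rfl⟩ | ⟨u, hu, k, rfl⟩⟩ := hF
      · exact ⟨c, hc, _, Or.inl ⟨k, rfl⟩, rfl⟩
      · exact ⟨c, hc, _, Or.inr ⟨u, hu, k, rfl⟩, rfl⟩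
    have h2 := typeAOn_le_span_summandsOn (i := b) (j := r) (S := Set.univ \ {a})
      ⟨⟨Set.mem_univ _, hra⟩, hrb⟩ hc
    show c ∈ N.comap (LinearMap.mulRight 𝕜 g)
    refine Submodule.span_le.2 ?_ h2
    intro F hF
    have hgA := typeAOn_le_typeA (hg.mem_typeAOn (Set.mem_univ _) (Set.mem_univ _))
    obtain ⟨d, hd, f, hf, rfl⟩ : ∃ d ∈ typeAOn 𝕜 ((Set.univ \ {a}) \ {b}),
        ∃ f, IsFactor (Set.univ \ {a}) b r f ∧ F = d * f := by
      obtain ⟨c, hc, ⟨k, rfl⟩ | ⟨u, hu, k, rfl⟩⟩ := hF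
      · exact ⟨c, hc, _, Or.inl ⟨k, rfl⟩, rfl⟩
      · exact ⟨c, hc, _, Or.inr ⟨u, hu, k, rfl⟩, rfl⟩
    have hfA : f ∈ typeA 𝕜 n := by
      obtain ⟨k, rfl⟩ | ⟨u, hu, k, rfl⟩ := hf
      · exact typeAOn_le_typeA (typeAOn_zpow (Set.mem_univ b) (Set.mem_univ r) k)
      · exact typeAOn_le_typeA
          (pow_mem (typeAOn_inv (Set.mem_univ b) (Set.mem_univ u) (Ne.symm hu.2)) _)
    exact ⟨⟨d * f * g, typeA_mul (typeA_mul (typeAOn_le_typeA hd) hfA) hgA⟩,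
      h d hd f g hf hg _ rfl, rfl⟩
  ext1 F
  obtain ⟨G, hG, e⟩ := hN F.2
  rwa [← Subtype.ext e]

theorem ct_zero (hij : i ≠ j) : ct 𝕜 i j 0 = 0 :=
  (IsConstantTerm.of_freeOf hij (zero_mem _)).ct_eq hij

/-- Here `f` may involve `x_i`: only its constant term survives `[k, l]`, and this is a scalar. -/
theorem ct_ct_mul_mul (hij : i ≠ j) (hkl : k ≠ l) {d f g : RatFun 𝕜 n} {e e' : 𝕜}
    (hdi : d ∈ freeOf 𝕜 i) (hdk : d ∈ freeOf 𝕜 k) (hg : g ∈ freeOf 𝕜 k)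
    (hf : IsConstantTerm k l f (algebraMap 𝕜 _ e))
    (hgc : IsConstantTerm i j g (algebraMap 𝕜 _ e')) :
    ct 𝕜 i j (ct 𝕜 k l (d * f * g)) = d * algebraMap 𝕜 _ e * algebraMap 𝕜 _ e' := by
  rw [mul_right_comm, (hf.mul (mul_mem hdk hg)).ct_eq hkl, mul_right_comm]
  exact (hgc.mul (mul_mem hdi ((freeOf 𝕜 i).algebraMap_mem e))).ct_eq hij

/-- `[i, j]` and `[k, l]` commute on products without poles at `x_i = x_k`. -/
theorem ct_comm_of_free (hij : i ≠ j) (hkl : k ≠ l) {d f g : RatFun 𝕜 n} {e e' : 𝕜}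
    (hdi : d ∈ freeOf 𝕜 i) (hdk : d ∈ freeOf 𝕜 k) (hf : f ∈ freeOf 𝕜 i) (hg : g ∈ freeOf 𝕜 k)
    (hfc : IsConstantTerm k l f (algebraMap 𝕜 _ e))
    (hgc : IsConstantTerm i j g (algebraMap 𝕜 _ e')) :
    ct 𝕜 i j (ct 𝕜 k l (d * f * g)) = ct 𝕜 k l (ct 𝕜 i j (d * f * g)) := by
  rw [ct_ct_mul_mul hij hkl hdi hdk hg hfc hgc, mul_right_comm d f g,
    ct_ct_mul_mul hkl hij hdk hdi hf hgc hfc, mul_right_comm]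

theorem IsFactor.mem_freeOf {r : Fin n} {F : RatFun 𝕜 n} (h : IsFactor (Set.univ \ {i}) k r F)
    (hik : i ≠ k) (hr : r ≠ i) : F ∈ freeOf 𝕜 i :=
  mem_freeOf_of_typeAOn (h.mem_typeAOn ⟨Set.mem_univ _, hik.symm⟩ ⟨Set.mem_univ _, hr⟩) (by simp)

/-- A pole at `x_i = x_k` is the only way in which a factor in `x_i` can involve `x_k`. -/
theorem IsFactor.mem_freeOf_or {r : Fin n} {F : RatFun 𝕜 n} (h : IsFactor Set.univ i r F)
    (hik : i ≠ k) (hri : r ≠ i) (hrk : r ≠ k) :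
    (F ∈ freeOf 𝕜 k ∧ IsConstantTerm i k F 0) ∨ ∃ m : ℕ, F = (1 - x 𝕜 i / x 𝕜 k)⁻¹ ^ (m + 1) := by
  obtain ⟨m, rfl⟩ | ⟨u, hu, m, rfl⟩ := h
  · exact Or.inl ⟨zpow_mem (div_mem (x_mem_freeOf hik) (x_mem_freeOf hrk)) m, .zpow hri m⟩
  · by_cases huk : u = k
    · exact Or.inr ⟨m, by rw [huk]⟩
    · refine Or.inl ⟨pow_mem (inv_mem (sub_mem (one_mem _)
        (div_mem (x_mem_freeOf hik) (x_mem_freeOf huk)))) _, ?_⟩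
      simpa only [if_neg (Ne.symm huk)] using IsConstantTerm.inv_pow (𝕜 := 𝕜) (j := k) hu.2 m

/-! ### Commutation for disjoint pairs of indices -/

theorem bracket_comm (hik : i ≠ k) (hil : i ≠ l) (hjk : j ≠ k) (hjl : j ≠ l) :
    bracket 𝕜 i j * bracket 𝕜 k l = bracket 𝕜 k l * bracket 𝕜 i j := by
  by_cases hij : i = j
  · simp [hij, bracket_self]
  by_cases hkl : k = l
  · simp [hkl, bracket_self]
  refine end_ext hil.symm (Ne.symm hkl) fun d hd f g hf hg F hF => Subtype.ext ?_
  simp only [Module.End.mul_apply, coe_bracket hij, coe_bracket hkl, hF]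
  have hdi : d ∈ freeOf 𝕜 i := mem_freeOf_of_typeAOn hd (by simp)
  have hdk : d ∈ freeOf 𝕜 k := mem_freeOf_of_typeAOn hd (by simp)
  have hfi := hf.mem_freeOf hik hil.symm
  obtain ⟨e, he⟩ := hf.exists_isConstantTerm (Ne.symm hkl) l
  obtain ⟨e', he'⟩ := hg.exists_isConstantTerm hil.symm j
  obtain ⟨hgk, -⟩ | ⟨m, rfl⟩ := hg.mem_freeOf_or hik hil.symm (Ne.symm hkl)
  · exact ct_comm_of_free hij hkl hdi hdk hfi hgk he he'
  · have h1 := (IsConstantTerm.inv_pow (𝕜 := 𝕜) (j := j) hik.symm m).mul (mul_mem hdi hfi)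
    rw [if_neg hjk, mul_zero] at h1
    rw [h1.ct_eq hij, ct_zero hkl, mul_assoc]
    have hg' : (1 - x 𝕜 i / x 𝕜 k)⁻¹ ^ (m + 1) ∈ typeAOn 𝕜 {i, k} :=
      pow_mem (typeAOn_inv (by simp) (by simp) hik) _
    -- The product `f * g` lives in `x_i`, `x_k` and one more variable `x_v`. If `v = l`, then `x_j`
    -- is absent and `[i, j]` kills the result of `[k, l]`; otherwise `x_l` is absent and `[k, l]`
    -- already gives `0`.
    obtain ⟨v, hv, hvj, hfv⟩ : ∃ v, (v = l ∨ l ∉ ({i, k, v} : Set (Fin n))) ∧ v ≠ k ∧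
        f ∈ typeAOn 𝕜 {i, k, v} := by
      obtain ⟨p, rfl⟩ | ⟨u, hu, p, rfl⟩ := hf
      · exact ⟨l, Or.inl rfl, Ne.symm hkl, typeAOn_zpow (by simp) (by simp) p⟩
      · refine ⟨u, ?_, hu.2, pow_mem (typeAOn_inv (by simp) (by simp) (Ne.symm hu.2)) _⟩
        by_cases hul : u = l
        · exact Or.inl hul
        · exact Or.inr (by simp [hil.symm, Ne.symm hkl, Ne.symm hul])
    have hA : f * (1 - x 𝕜 i / x 𝕜 k)⁻¹ ^ (m + 1) ∈ typeAOn 𝕜 {i, k, v} :=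
      mul_mem hfv (typeAOn_mono (by intro a; simp; tauto) hg')
    rw [ct_mul hkl hdk (typeAOn_le_typeA hA)]
    have hB := ct_mem_typeAOn hkl hA
    rw [ct_mul hij hdi (typeAOn_le_typeA hB)]
    obtain rfl | hv := hv
    · rw [ct_eq_zero_of_typeAOn hij hB, mul_zero]
      right
      simp [hjk, hjl, Ne.symm hij]
    · rw [ct_eq_zero_of_typeAOn hkl hA (Or.inr hv), ct_zero hij, mul_zero]

/-! ### The three-term relation -/

/-- Positive powers of `1 / (1 - x_i / x_j)` have constant term `1`, and constants have `0`; so the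
nonconstant coefficients of `g` are added up. -/
theorem IsConstantTerm.aeval_inv (hij : i ≠ j) (g : 𝕜[X]) :
    IsConstantTerm i j (aeval (1 - x 𝕜 i / x 𝕜 j)⁻¹ g)
      (algebraMap 𝕜 _ (g.eval 1 - g.eval 0)) := by
  induction g using Polynomial.induction_on' with
  | add p q hp hq =>
    have h := hp.add hq
    rw [← map_add, ← map_add] at h
    convert h using 2
    simp only [eval_add]
    ring
  | monomial m a =>
    rw [← C_mul_X_pow_eq_monomial, map_mul, aeval_C, map_pow, aeval_X]
    cases m with
    | zero =>
      have h := IsConstantTerm.of_freeOf (𝕜 := 𝕜) hij ((freeOf 𝕜 i).algebraMap_mem a)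
      simpa using h
    | succ m =>
      have h := (IsConstantTerm.inv_pow (𝕜 := 𝕜) (j := j) hij.symm m).mul
        ((freeOf 𝕜 i).algebraMap_mem a)
      simpa using h

theorem inv_mul_inv_swap (hij : i ≠ j) (hik : i ≠ k) (hjk : j ≠ k) :
    (1 - x 𝕜 i / x 𝕜 k)⁻¹ * (1 - x 𝕜 j / x 𝕜 i)⁻¹ =
      (1 - x 𝕜 j / x 𝕜 k)⁻¹ * ((1 - x 𝕜 i / x 𝕜 k)⁻¹ - 1 + (1 - x 𝕜 j / x 𝕜 i)⁻¹) := by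
  have h1 := one_sub_ne_zero (𝕜 := 𝕜) hik
  have h2 := one_sub_ne_zero (𝕜 := 𝕜) hij.symm
  have h3 := one_sub_ne_zero (𝕜 := 𝕜) hjk
  have h4 : x 𝕜 j / x 𝕜 k = (x 𝕜 i / x 𝕜 k) * (x 𝕜 j / x 𝕜 i) := by
    rw [mul_comm, div_mul_div_cancel₀ (x_ne_zero i)]
  rw [h4] at h3 ⊢
  generalize x 𝕜 i / x 𝕜 k = y at *
  generalize x 𝕜 j / x 𝕜 i = z at *
  field_simp
  ring

/-- Let `a`, `b`, `W` be the inverses of `1 - x_i / x_k`, `1 - x_j / x_i`, `1 - x_j / x_k`. The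
identity `a b = W (a - 1 + b)` reduces the exponents of `a ^ (m + 1) * b ^ p`. Each step multiplies
by `W`, whence `g(0) = 0`, and keeps the value at `1`, as `1 - 1 + 1 = 1`. Pure powers of `b` do not
involve `x_k` and contribute `0`. -/
theorem IsConstantTerm.exists_aeval (hij : i ≠ j) (hik : i ≠ k) (hjk : j ≠ k) (m p : ℕ) :
    ∃ g : 𝕜[X], IsConstantTerm i k
      ((1 - x 𝕜 i / x 𝕜 k)⁻¹ ^ (m + 1) * (1 - x 𝕜 j / x 𝕜 i)⁻¹ ^ p)
      (aeval (1 - x 𝕜 j / x 𝕜 k)⁻¹ g) ∧ g.eval 1 = 1 ∧ (p ≠ 0 → g.eval 0 = 0) := by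
  have hW : (1 - x 𝕜 j / x 𝕜 k)⁻¹ ∈ freeOf 𝕜 i :=
    inv_mem (sub_mem (one_mem _) (div_mem (x_mem_freeOf hij.symm) (x_mem_freeOf hik.symm)))
  have hB : ∀ p : ℕ, IsConstantTerm i k ((1 - x 𝕜 j / x 𝕜 i)⁻¹ ^ p) 0 := by
    intro p
    have h : (1 - x 𝕜 j / x 𝕜 i)⁻¹ ^ p ∈ typeAOn 𝕜 {j, i} :=
      pow_mem (typeAOn_inv (by simp) (by simp) hij.symm) p
    have h2 := isConstantTerm_ct hik (typeAOn_le_typeA h)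
    rwa [ct_eq_zero_of_typeAOn hik h (Or.inr (by simp [hik.symm, hjk.symm]))] at h2
  have hstep := inv_mul_inv_swap (𝕜 := 𝕜) hij hik hjk
  induction p generalizing m with
  | zero =>
    refine ⟨1, ?_, by simp, by simp⟩
    simpa using IsConstantTerm.inv_pow (𝕜 := 𝕜) (j := k) hik.symm m
  | succ p ihp =>
    induction m with
    | zero =>
      obtain ⟨g, hg, h1, -⟩ := ihp 0
      refine ⟨X * g, ?_, by simp [h1], by simp⟩
      have h := ((hg.add ((hB p).smul (-1))).add (hB (p + 1))).mul hW
      rw [map_mul, aeval_X]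
      convert h using 1
      · generalize (1 - x 𝕜 i / x 𝕜 k)⁻¹ = a at *
        generalize (1 - x 𝕜 j / x 𝕜 i)⁻¹ = b at *
        rw [neg_one_smul]
        linear_combination b ^ p * hstep
      · simp
    | succ m ihm =>
      obtain ⟨g₁, hg₁, h₁, -⟩ := ihp (m + 1)
      obtain ⟨g₂, hg₂, h₂, -⟩ := ihp m
      obtain ⟨g₃, hg₃, h₃, -⟩ := ihm
      refine ⟨X * (g₁ - g₂ + g₃), ?_, by simp [h₁, h₂, h₃], by simp⟩
      have h := ((hg₁.add (hg₂.smul (-1))).add hg₃).mul hW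
      rw [map_mul, aeval_X]
      convert h using 1
      · generalize (1 - x 𝕜 i / x 𝕜 k)⁻¹ = a at *
        generalize (1 - x 𝕜 j / x 𝕜 i)⁻¹ = b at *
        rw [neg_one_smul]
        linear_combination a ^ (m + 1) * b ^ p * hstep
      · simp [sub_eq_add_neg]

theorem bracket_mul_bracket (hij : i ≠ j) (hik : i ≠ k) (hjk : j ≠ k) :
    bracket 𝕜 i k * bracket 𝕜 j i =
      bracket 𝕜 j k * bracket 𝕜 i k - bracket 𝕜 i k * bracket 𝕜 j k := by
  refine end_ext hjk.symm hik.symm fun d hd f g hf hg F hF => Subtype.ext ?_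
  simp only [LinearMap.sub_apply, Submodule.coe_sub, Module.End.mul_apply, coe_bracket hik,
    coe_bracket hjk, coe_bracket hij.symm, hF]
  have hdi : d ∈ freeOf 𝕜 i := mem_freeOf_of_typeAOn hd (by simp)
  have hdj : d ∈ freeOf 𝕜 j := mem_freeOf_of_typeAOn hd (by simp)
  have hfj := hf.mem_freeOf hij.symm hjk.symm
  obtain ⟨hgi, hgc⟩ | ⟨p, rfl⟩ := hg.mem_freeOf_or hij.symm hjk.symm hik.symm
  · obtain ⟨e, he⟩ := hf.exists_isConstantTerm hik.symm k
    obtain ⟨e', he'⟩ := hg.exists_isConstantTerm hjk.symm k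
    rw [ct_comm_of_free hjk hik hdj hdi hfj hgi he he', sub_self,
      (hgc.mul (mul_mem hdj hfj)).ct_eq hij.symm, mul_zero, ct_zero hik]
  · have h1 := (IsConstantTerm.inv_pow (𝕜 := 𝕜) (j := i) hij p).mul (mul_mem hdj hfj)
    have h2 := (IsConstantTerm.inv_pow (𝕜 := 𝕜) (j := k) hij p).mul (mul_mem hdj hfj)
    rw [if_pos rfl, mul_one] at h1
    rw [if_neg hik.symm, mul_zero] at h2
    rw [h1.ct_eq hij.symm, h2.ct_eq hjk, ct_zero hik, sub_zero]
    -- With `g` a pole at `x_j = x_i`, the remaining claim is `[i, k](d f) = [j, k][i, k](d f g)`,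
    -- and `d` can be taken out of both sides.
    have hB : (1 - x 𝕜 j / x 𝕜 i)⁻¹ ^ (p + 1) ∈ typeAOn 𝕜 {i, j} :=
      pow_mem (typeAOn_inv (by simp) (by simp) hij.symm) _
    have hfA : f ∈ typeAOn 𝕜 Set.univ :=
      typeAOn_mono (Set.subset_univ _) (hf.mem_typeAOn ⟨trivial, hij⟩ ⟨trivial, hjk.symm⟩)
    have hfg := mul_mem hfA (typeAOn_mono (Set.subset_univ _) hB)
    obtain ⟨c, hc, hc'⟩ : ∃ c : 𝕜, IsConstantTerm i k f (algebraMap 𝕜 _ c) ∧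
        ct 𝕜 j k (ct 𝕜 i k (f * (1 - x 𝕜 j / x 𝕜 i)⁻¹ ^ (p + 1))) = algebraMap 𝕜 _ c := by
      obtain ⟨m, rfl⟩ | ⟨u, hu, m, rfl⟩ := hf
      · refine ⟨0, by simpa using IsConstantTerm.zpow hik.symm m, ?_⟩
        have hA : (x 𝕜 i / x 𝕜 j) ^ m * (1 - x 𝕜 j / x 𝕜 i)⁻¹ ^ (p + 1) ∈ typeAOn 𝕜 {i, j} :=
          mul_mem (typeAOn_zpow (by simp) (by simp) m) hB
        -- Split off `x_j / x_k`, which is free of `x_i`; what remains does not involve `x_k`.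
        rw [← div_mul_div_cancel₀ (x_ne_zero (𝕜 := 𝕜) j), mul_comm (x 𝕜 i / x 𝕜 j), mul_zpow,
          mul_assoc, ct_mul hik (zpow_mem (div_mem (x_mem_freeOf hij.symm)
            (x_mem_freeOf hik.symm)) m) (typeAOn_le_typeA hA),
          ct_eq_zero_of_typeAOn hik hA (Or.inr (by simp [hik.symm, hjk.symm])), mul_zero,
          ct_zero hjk, map_zero]
      · by_cases huk : u = k
        · subst huk
          refine ⟨1, ?_, ?_⟩
          · simpa using IsConstantTerm.inv_pow (𝕜 := 𝕜) (j := u) hik.symm m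
          · obtain ⟨q, hq, hq1, hq0⟩ := IsConstantTerm.exists_aeval (𝕜 := 𝕜) hij hik hjk m (p + 1)
            rw [hq.ct_eq hik, (IsConstantTerm.aeval_inv hjk q).ct_eq hjk, hq1,
              hq0 (Nat.succ_ne_zero p), sub_zero]
        · refine ⟨0, ?_, ?_⟩
          · simpa [Ne.symm huk] using IsConstantTerm.inv_pow (𝕜 := 𝕜) (j := k) hu.2 m
          · have hA : (1 - x 𝕜 i / x 𝕜 u)⁻¹ ^ (m + 1) * (1 - x 𝕜 j / x 𝕜 i)⁻¹ ^ (p + 1) ∈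
                typeAOn 𝕜 {i, j, u} :=
              mul_mem (pow_mem (typeAOn_inv (by simp) (by simp) (Ne.symm hu.2)) _)
                (typeAOn_mono (by intro a; simp; tauto) hB)
            rw [ct_eq_zero_of_typeAOn hik hA
              (Or.inr (by simp [hik.symm, hjk.symm, Ne.symm huk])), ct_zero hjk, map_zero]
    rw [(hc.mul hdi).ct_eq hik, mul_assoc, ct_mul hik hdi (typeAOn_le_typeA hfg),
      ct_mul hjk hdj (typeAOn_le_typeA (ct_mem_typeAOn hik hfg)), hc']

/-- All coefficients are scalars here, so only powers of `1 / (1 - x_i / x_j) = 1 - 1 / (1 - x_j /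
x_i)` matter. In terms of `x_j` such a power is `(1 - X) ^ (m + 1)` at `1 / (1 - x_j / x_i)`, and
`IsConstantTerm.aeval_inv` gives `0 - 1`. -/
theorem ct_swap (hij : i ≠ j) {F : RatFun 𝕜 n} (hF : F ∈ typeAOn 𝕜 {i, j}) :
    ct 𝕜 i j F = -ct 𝕜 j i F := by
  suffices ∃ c, IsConstantTerm i j F c ∧ IsConstantTerm j i F (-c) by
    obtain ⟨c, h1, h2⟩ := this
    rw [h1.ct_eq hij, h2.ct_eq hij.symm, neg_neg]
  have hspan := typeAOn_le_span_summandsOn (i := i) (j := j) (by simp [hij.symm]) hF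
  clear hF
  induction hspan using Submodule.span_induction with
  | mem F hF =>
    obtain ⟨c, hc, h⟩ := hF
    have hs : (({i, j} : Set (Fin n)) \ {i}).Subsingleton := by
      refine Set.subsingleton_of_subset_singleton (a := j) ?_
      intro a
      simp
      tauto
    obtain ⟨r, rfl⟩ := Algebra.mem_bot.1 (typeAOn_le_bot hs hc)
    obtain ⟨m, rfl⟩ | ⟨u, hu, m, rfl⟩ := h
    · refine ⟨0, ?_, ?_⟩
      · simpa using (IsConstantTerm.zpow hij.symm m).mul ((freeOf 𝕜 i).algebraMap_mem r)
      · rw [← inv_div, inv_zpow, ← zpow_neg]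
        simpa using (IsConstantTerm.zpow hij (-m)).mul ((freeOf 𝕜 j).algebraMap_mem r)
    · obtain rfl : u = j := by
        have := hu.1
        have := hu.2
        simp_all
      refine ⟨algebraMap 𝕜 _ r, ?_, ?_⟩
      · simpa using (IsConstantTerm.inv_pow (j := u) hij.symm m).mul
          ((freeOf 𝕜 i).algebraMap_mem r)
      · have h := (IsConstantTerm.aeval_inv hij.symm ((1 - X) ^ (m + 1) : 𝕜[X])).mul
          ((freeOf 𝕜 u).algebraMap_mem r)
        convert h using 1
        · have h1 := one_sub_ne_zero (𝕜 := 𝕜) hij.symm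
          have h2 := x_ne_zero (𝕜 := 𝕜) i
          have h3 := x_ne_zero (𝕜 := 𝕜) u
          rw [one_sub_swap hij]
          simp only [map_pow, map_sub, map_one, aeval_X]
          congr 2
          rw [one_sub_div h2] at h1 ⊢
          rw [div_ne_zero_iff] at h1
          have := h1.1
          field_simp
          ring
        · simp
  | zero => exact ⟨0, .of_freeOf hij (zero_mem _), by simpa using .of_freeOf hij.symm (zero_mem _)⟩
  | add F G _ _ hF hG =>
    obtain ⟨c, hc, hc'⟩ := hF
    obtain ⟨d, hd, hd'⟩ := hG
    refine ⟨c + d, hc.add hd, ?_⟩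
    rw [neg_add]
    exact hc'.add hd'
  | smul r F _ hF =>
    obtain ⟨c, hc, hc'⟩ := hF
    refine ⟨r • c, hc.smul r, ?_⟩
    rw [← smul_neg]
    exact hc'.smul r

end Relations

/-! ### Words in the operators -/

section Words

variable {𝕜 : Type*} [Field 𝕜] {n : ℕ} {S : Set (Fin n)} {i j k : Fin n}

variable (𝕜) in
/-- The composition of the operators `[i, j]` along a list of pairs `(i, j)`. -/
def wordProd (w : List (Fin n × Fin n)) : Module.End 𝕜 (typeA 𝕜 n) :=
  (w.map fun e => bracket 𝕜 e.1 e.2).prod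

@[simp] theorem wordProd_nil : wordProd 𝕜 ([] : List (Fin n × Fin n)) = 1 := rfl

@[simp] theorem wordProd_cons (e : Fin n × Fin n) (w : List (Fin n × Fin n)) :
    wordProd 𝕜 (e :: w) = bracket 𝕜 e.1 e.2 * wordProd 𝕜 w := by
  simp [wordProd]

@[simp] theorem wordProd_append (v w : List (Fin n × Fin n)) :
    wordProd 𝕜 (v ++ w) = wordProd 𝕜 v * wordProd 𝕜 w := by
  simp [wordProd]

theorem wordProd_mem_typeAOn (w : List (Fin n × Fin n)) {F : typeA 𝕜 n}
    (hF : (F : RatFun 𝕜 n) ∈ typeAOn 𝕜 S) :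
    (wordProd 𝕜 w F : RatFun 𝕜 n) ∈ typeAOn 𝕜 (S \ {i | ∃ e ∈ w, e.1 = i}) := by
  induction w with
  | nil => simpa using hF
  | cons e w ih =>
    rw [wordProd_cons, Module.End.mul_apply]
    refine typeAOn_mono ?_ (bracket_mem_typeAOn ih)
    intro a
    simp
    grind

theorem wordProd_apply_eq_zero {w : List (Fin n × Fin n)} {F : typeA 𝕜 n}
    (hF : (F : RatFun 𝕜 n) ∈ typeAOn 𝕜 S) {e : Fin n × Fin n} (he : e ∈ w)
    (h : e.1 ∉ S ∨ e.2 ∉ S) : wordProd 𝕜 w F = 0 := by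
  induction w with
  | nil => simp at he
  | cons f w ih =>
    rw [wordProd_cons, Module.End.mul_apply]
    obtain rfl | he := List.mem_cons.1 he
    · exact bracket_eq_zero_of_typeAOn
        (typeAOn_mono Set.sdiff_subset (wordProd_mem_typeAOn w hF)) h
    · rw [ih he, map_zero]

/-- The operator of `f` acts before that of `e` and removes a variable that the latter needs. -/
theorem wordProd_eq_zero {v w : List (Fin n × Fin n)} {e f : Fin n × Fin n} (he : e ∈ v)
    (h : e.1 = f.1 ∨ e.2 = f.1) : wordProd 𝕜 (v ++ f :: w) = 0 := by
  ext1 F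
  rw [wordProd_append, wordProd_cons, Module.End.mul_apply, Module.End.mul_apply,
    LinearMap.zero_apply]
  refine wordProd_apply_eq_zero
    (bracket_mem_typeAOn (wordProd_mem_typeAOn w (mem_typeAOn_univ F.2))) he ?_
  rcases h with h | h <;> simp [h]

theorem bracket_mul_bracket_eq_zero (h : i = k ∨ j = k) (l : Fin n) :
    bracket 𝕜 i j * bracket 𝕜 k l = 0 := by
  simpa using wordProd_eq_zero (𝕜 := 𝕜) (v := [(i, j)]) (w := []) (e := (i, j)) (f := (k, l))
    (by simp) h

theorem bracket_mul_bracket_comm (hij : i ≠ j) (hik : i ≠ k) (hjk : j ≠ k) :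
    bracket 𝕜 j k * bracket 𝕜 i k =
      bracket 𝕜 i k * bracket 𝕜 j k + bracket 𝕜 i k * bracket 𝕜 j i := by
  ext1 F
  have h := LinearMap.congr_fun (bracket_mul_bracket (𝕜 := 𝕜) hij hik hjk) F
  rw [LinearMap.add_apply, h, LinearMap.sub_apply, add_sub_cancel]

theorem bracket_mul_bracket_swap (hij : i ≠ j) (hik : i ≠ k) (hjk : j ≠ k) :
    bracket 𝕜 i k * bracket 𝕜 j i = (-1 : 𝕜) • (bracket 𝕜 j k * bracket 𝕜 i j) := by
  ext1 F
  have h := LinearMap.congr_fun (bracket_mul_bracket (𝕜 := 𝕜) hij hik hjk) F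
  have h' := LinearMap.congr_fun (bracket_mul_bracket (𝕜 := 𝕜) hij.symm hjk hik) F
  rw [LinearMap.smul_apply, h, h', LinearMap.sub_apply, LinearMap.sub_apply, neg_one_smul, neg_sub]

variable (𝕜) in
/-- The span of the words of length `k` with increasing sources that are at least `m`. -/
def sortedSpan (n m k : ℕ) : Submodule 𝕜 (Module.End 𝕜 (typeA 𝕜 n)) :=
  Submodule.span 𝕜 {T | ∃ w : List (Fin n × Fin n), w.Pairwise (fun e f => e.1 < f.1) ∧
    (∀ e ∈ w, m ≤ (e.1 : ℕ)) ∧ w.length = k ∧ T = wordProd 𝕜 w}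

theorem mul_mem_of_mem_span {B : Type*} [Semiring B] [Algebra 𝕜 B] {s : Set B} {N : Submodule 𝕜 B}
    {a b : B} (h : ∀ c ∈ s, a * c ∈ N) (hb : b ∈ Submodule.span 𝕜 s) : a * b ∈ N := by
  have : Submodule.span 𝕜 s ≤ N.comap (LinearMap.mulLeft 𝕜 a) := Submodule.span_le.2 h
  exact this hb

theorem bracket_mul_mem_sortedSpan_of_lt {m l : ℕ} {T : Module.End 𝕜 (typeA 𝕜 n)}
    (hT : T ∈ sortedSpan 𝕜 n (i + 1) l) (hm : m ≤ i) (j : Fin n) :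
    bracket 𝕜 i j * T ∈ sortedSpan 𝕜 n m (l + 1) := by
  refine mul_mem_of_mem_span ?_ hT
  rintro _ ⟨w, hw, hi, hl, rfl⟩
  refine Submodule.subset_span ⟨(i, j) :: w, List.pairwise_cons.2 ⟨fun e he => ?_, hw⟩, ?_,
    by simp [hl], by simp⟩
  · exact Fin.lt_def.2 (hi e he)
  · intro e he
    obtain rfl | he := List.mem_cons.1 he
    · exact hm
    · exact hm.trans ((Nat.le_succ _).trans (hi e he))

/-- Insertion sort. For `a < b` every product `[b, y][a, z]` is `0` or a combination of products
`[a, z'][b, y']`. Induction places `[b, y']` among sources greater than `a`, so `a` can stay in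
front; the bound `m` records this. -/
theorem bracket_mul_wordProd_mem_sortedSpan (w : List (Fin n × Fin n)) (m : ℕ)
    (hw : w.Pairwise (fun e f => e.1 < f.1)) (hm : ∀ e ∈ w, m ≤ (e.1 : ℕ)) (b y : Fin n)
    (hb : m ≤ b) : bracket 𝕜 b y * wordProd 𝕜 w ∈ sortedSpan 𝕜 n m (w.length + 1) := by
  induction w generalizing m b y with
  | nil => exact Submodule.subset_span ⟨[(b, y)], by simp, by simpa using hb, by simp, by simp⟩
  | cons e w ih =>
    obtain ⟨a, z⟩ := e
    have hw' := List.pairwise_cons.1 hw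
    have ha : m ≤ a := hm (a, z) (by simp)
    rcases lt_trichotomy b a with hba | rfl | hab
    · refine Submodule.subset_span ⟨(b, y) :: (a, z) :: w, List.pairwise_cons.2 ⟨?_, hw⟩, ?_,
        by simp, by simp⟩
      · intro e he
        obtain rfl | he := List.mem_cons.1 he
        · exact hba
        · exact hba.trans (hw'.1 e he)
      · intro e he
        obtain rfl | he := List.mem_cons.1 he
        · exact hb
        · exact hm e he
    · rw [wordProd_cons, ← mul_assoc, bracket_mul_bracket_eq_zero (Or.inl rfl), zero_mul]
      exact zero_mem _
    · have key : ∀ y' z', bracket 𝕜 a z' * bracket 𝕜 b y' * wordProd 𝕜 w ∈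
          sortedSpan 𝕜 n m (w.length + 1 + 1) := by
        intro y' z'
        rw [mul_assoc]
        exact bracket_mul_mem_sortedSpan_of_lt
          (ih (a + 1) hw'.2 (fun e he => hw'.1 e he) b y' hab) ha z'
      rw [wordProd_cons, ← mul_assoc, List.length_cons]
      show bracket 𝕜 b y * bracket 𝕜 a z * wordProd 𝕜 w ∈ _
      by_cases hya : y = a
      · rw [bracket_mul_bracket_eq_zero (Or.inr hya), zero_mul]
        exact zero_mem _
      by_cases haz : a = z
      · rw [haz, bracket_self, mul_zero, zero_mul]
        exact zero_mem _
      by_cases hby : b = y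
      · rw [hby, bracket_self, zero_mul, zero_mul]
        exact zero_mem _
      by_cases hbz : b = z
      · subst hbz
        rw [bracket_mul_bracket_swap hab.ne' hby (Ne.symm hya), smul_mul_assoc]
        exact Submodule.smul_mem _ _ (key _ _)
      by_cases hyz : y = z
      · subst hyz
        rw [bracket_mul_bracket_comm hab.ne (Ne.symm hya) hby, add_mul]
        exact add_mem (key _ _) (key _ _)
      · rw [bracket_comm hab.ne' hbz hya hyz]
        exact key _ _

theorem bracket_mul_mem_sortedSpan {m l : ℕ} {T : Module.End 𝕜 (typeA 𝕜 n)}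
    (hT : T ∈ sortedSpan 𝕜 n m l) (hm : m ≤ i) (j : Fin n) :
    bracket 𝕜 i j * T ∈ sortedSpan 𝕜 n m (l + 1) := by
  refine mul_mem_of_mem_span ?_ hT
  rintro _ ⟨w, hw, hi, rfl, rfl⟩
  exact bracket_mul_wordProd_mem_sortedSpan w m hw hi i j hm

theorem wordProd_mem_sortedSpan (w : List (Fin n × Fin n)) :
    wordProd 𝕜 w ∈ sortedSpan 𝕜 n 0 w.length := by
  induction w with
  | nil => exact Submodule.subset_span ⟨[], by simp, by simp, rfl, rfl⟩
  | cons e w ih =>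
    rw [wordProd_cons]
    exact bracket_mul_mem_sortedSpan ih (Nat.zero_le _) _

/-- The edge lists of nearly increasing forests, ordered by increasing sources. -/
structure IsForestWord (w : List (Fin n × Fin n)) : Prop where
  sorted : w.Pairwise (fun e f => e.1 < f.1)
  ne : ∀ e ∈ w, e.1 ≠ e.2
  nearly_increasing : ∀ e ∈ w, ∀ f ∈ w, e.2 = f.1 → e.2 < e.1

/-- If `e.2 = f.1` and `e.1 < f.1`, then `f` stands to the right of `e` and removes the target
variable of `e` first. -/
theorem wordProd_eq_zero_of_not_isForestWord {w : List (Fin n × Fin n)}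
    (hw : w.Pairwise (fun e f => e.1 < f.1)) (h : ¬ IsForestWord w) : wordProd 𝕜 w = 0 := by
  by_cases h1 : ∀ e ∈ w, e.1 ≠ e.2
  swap
  · push Not at h1
    obtain ⟨e, he, h1⟩ := h1
    refine List.prod_eq_zero (List.mem_map.2 ⟨e, he, ?_⟩)
    rw [h1, bracket_self]
  by_cases h2 : ∀ e ∈ w, ∀ f ∈ w, e.2 = f.1 → e.2 < e.1
  · exact absurd ⟨hw, h1, h2⟩ h
  push Not at h2
  obtain ⟨e, he, f, hf, hef, hlt⟩ := h2
  have hlt : e.1 < f.1 := hef ▸ lt_of_le_of_ne hlt (h1 e he)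
  obtain ⟨u, v, rfl⟩ := List.append_of_mem hf
  have hw' := List.pairwise_cons.1 (List.pairwise_append.1 hw).2.1
  refine wordProd_eq_zero (e := e) ?_ (Or.inr hef)
  rcases List.mem_append.1 he with he | he
  · exact he
  · rcases List.mem_cons.1 he with rfl | he
    · exact absurd hlt (lt_irrefl _)
    · exact absurd hlt (hw'.1 e he).asymm

theorem IsForestWord.nodup_sources {w : List (Fin n × Fin n)} (h : IsForestWord w) :
    (w.map Prod.fst).Nodup :=
  (List.pairwise_map.2 h.sorted).imp ne_of_lt

/-- If all vertices were sources, then the target of the edge from `0` would be a source too, hence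
less than `0`. -/
theorem IsForestWord.length_lt {w : List (Fin n × Fin n)} (h : IsForestWord w) (hn : 1 ≤ n) :
    w.length < n := by
  have h1 := h.nodup_sources.length_le_card
  rw [List.length_map, Fintype.card_fin] at h1
  refine lt_of_le_of_ne h1 fun h2 => ?_
  have h3 : (w.map Prod.fst).toFinset = Finset.univ := by
    rw [← Finset.card_eq_iff_eq_univ, List.toFinset_card_of_nodup h.nodup_sources]
    simp [h2]
  have h4 : ∀ a : Fin n, ∃ e ∈ w, e.1 = a := fun a => by
    have : a ∈ (w.map Prod.fst).toFinset := h3 ▸ Finset.mem_univ a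
    simpa using this
  obtain ⟨e, he, he0⟩ := h4 ⟨0, hn⟩
  obtain ⟨f, hf, hfe⟩ := h4 e.2
  have := Fin.lt_def.1 (h.nearly_increasing e he f hf hfe.symm)
  rw [he0] at this
  exact absurd this (Nat.not_lt_zero _)

/-- The edge lists of the forests that index the basis. -/
structure IsBasicWord (w : List (Fin n × Fin n)) : Prop extends IsForestWord w where
  pos_of_length : w.length + 1 = n → ∀ e ∈ w, (e.1 : ℕ) ≠ 0

theorem bracket_mul_wordProd_swap {w : List (Fin n × Fin n)} (hij : i ≠ j)
    (h : ∀ a, a ≠ i → a ≠ j → ∃ e ∈ w, e.1 = a) :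
    bracket 𝕜 i j * wordProd 𝕜 w = (-1 : 𝕜) • (bracket 𝕜 j i * wordProd 𝕜 w) := by
  ext1 F
  refine Subtype.ext ?_
  simp only [LinearMap.smul_apply, Submodule.coe_smul, Module.End.mul_apply, coe_bracket hij,
    coe_bracket hij.symm]
  rw [neg_one_smul]
  refine ct_swap hij (typeAOn_mono ?_ (wordProd_mem_typeAOn w (mem_typeAOn_univ F.2)))
  intro a ha
  by_contra h2
  simp only [Set.mem_insert_iff, Set.mem_singleton_iff, not_or] at h2
  exact ha.2 (h a h2.1 h2.2)

/-- Only forest words of length `n - 1` with source `0` need rewriting. Reversing the edge at `0` by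
`bracket_mul_wordProd_swap` makes all sources positive, and sorting again keeps them so. -/
theorem sortedSpan_le_span_isBasicWord (k : ℕ) :
    sortedSpan 𝕜 n 0 k ≤ Submodule.span 𝕜 {T | ∃ w : List (Fin n × Fin n),
      IsBasicWord w ∧ T = wordProd 𝕜 w} := by
  have h1 : sortedSpan 𝕜 n 1 k ≤ Submodule.span 𝕜 {T | ∃ w : List (Fin n × Fin n),
      IsBasicWord w ∧ T = wordProd 𝕜 w} := by
    refine Submodule.span_le.2 ?_
    rintro _ ⟨w, hw, h1, -, rfl⟩
    by_cases h : IsForestWord w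
    · exact Submodule.subset_span ⟨w, ⟨h, fun _ e he => Nat.one_le_iff_ne_zero.1 (h1 e he)⟩, rfl⟩
    · rw [wordProd_eq_zero_of_not_isForestWord hw h]
      exact zero_mem _
  refine Submodule.span_le.2 ?_
  rintro _ ⟨w, hw, -, hk, rfl⟩
  by_cases h : IsForestWord w
  swap
  · rw [wordProd_eq_zero_of_not_isForestWord hw h]
    exact zero_mem _
  by_cases hb : IsBasicWord w
  · exact Submodule.subset_span ⟨w, hb, rfl⟩
  obtain ⟨hl, e, he, he0⟩ : w.length + 1 = n ∧ ∃ e ∈ w, (e.1 : ℕ) = 0 := by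
    by_contra h2
    refine hb ⟨h, fun hl e he he0 => h2 ⟨hl, e, he, he0⟩⟩
  cases w with
  | nil => simp at he
  | cons f w =>
    have hs := List.pairwise_cons.1 hw
    -- The label `0` is the least, so the edge that starts there is the first one.
    obtain rfl : e = f := by
      rcases List.mem_cons.1 he with rfl | he
      · rfl
      · have := Fin.lt_def.1 (hs.1 e he)
        omega
    have hne := h.ne e he
    have hw1 : ∀ f ∈ w, 1 ≤ (f.1 : ℕ) := fun f hf => by
      have := Fin.lt_def.1 (hs.1 f hf)
      omega
    have hj : ∀ f ∈ w, f.1 ≠ e.2 := fun f hf hfe => by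
      have := Fin.lt_def.1 (h.nearly_increasing e he f (List.mem_cons_of_mem _ hf) hfe.symm)
      omega
    have hi : ∀ f ∈ w, f.1 ≠ e.1 := fun f hf => (hs.1 f hf).ne'
    have hnd : (e.2 :: (e :: w).map Prod.fst).Nodup := by
      refine List.nodup_cons.2 ⟨?_, h.nodup_sources⟩
      simp only [List.map_cons, List.mem_cons, List.mem_map, not_or, not_exists, not_and]
      exact ⟨hne.symm, fun f hf => hj f hf⟩
    -- The `n - 1` sources and `e.2` are distinct, so they exhaust all vertices.
    have hall : ∀ a, a ≠ e.1 → a ≠ e.2 → ∃ f ∈ w, f.1 = a := by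
      intro a ha1 ha2
      have h3 : (e.2 :: (e :: w).map Prod.fst).toFinset = Finset.univ := by
        rw [← Finset.card_eq_iff_eq_univ, List.toFinset_card_of_nodup hnd, Fintype.card_fin]
        simpa using hl
      have : a ∈ (e.2 :: (e :: w).map Prod.fst).toFinset := h3 ▸ Finset.mem_univ a
      simpa [ha1, ha2] using this
    show wordProd 𝕜 (e :: w) ∈ _
    rw [wordProd_cons, bracket_mul_wordProd_swap hne hall]
    refine Submodule.smul_mem _ _ (h1 ?_)
    rw [← hk]
    refine bracket_mul_wordProd_mem_sortedSpan w 1 hs.2 hw1 _ _ ?_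
    refine Nat.one_le_iff_ne_zero.2 fun h0 => hne (Fin.ext (he0.trans h0.symm))

theorem span_isBasicWord :
    Submodule.span 𝕜 {T | ∃ w : List (Fin n × Fin n), IsBasicWord w ∧ T = wordProd 𝕜 w} =
      Subalgebra.toSubmodule (constantTermAlgebra 𝕜 n) := by
  refine le_antisymm (Submodule.span_le.2 ?_) ?_
  · rintro _ ⟨w, hw, rfl⟩
    refine list_prod_mem (S := constantTermAlgebra 𝕜 n) ?_
    intro T hT
    obtain ⟨e, he, rfl⟩ := List.mem_map.1 hT
    refine Algebra.subset_adjoin ⟨e.1, e.2, hw.ne e he, ?_⟩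
    rw [bracket, dif_pos (hw.ne e he)]
  · rw [constantTermAlgebra, Algebra.adjoin_eq_span, Submodule.span_le]
    intro T hT
    obtain ⟨w, rfl⟩ : ∃ w : List (Fin n × Fin n), T = wordProd 𝕜 w := by
      induction hT using Submonoid.closure_induction with
      | mem T hT =>
        obtain ⟨i, j, hij, rfl⟩ := hT
        exact ⟨[(i, j)], by simp [bracket, hij]⟩
      | one => exact ⟨[], rfl⟩
      | mul T T' _ _ h h' =>
        obtain ⟨w, rfl⟩ := h
        obtain ⟨w', rfl⟩ := h'
        exact ⟨w ++ w', by simp⟩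
    exact sortedSpan_le_span_isBasicWord _ (wordProd_mem_sortedSpan w)

end Words

/-! ### Linear independence -/

section Independence

variable {𝕜 : Type*} [Field 𝕜] {n : ℕ}

/-- A triangularity criterion for linear independence. -/
theorem linearIndependent_of_rank {ι V W : Type*} [AddCommGroup V] [Module 𝕜 V]
    [AddCommGroup W] [Module 𝕜 W] (v : ι → V) (rank : ι → ℕ)
    (h : ∀ a, ∃ f : V →ₗ[𝕜] W, f (v a) ≠ 0 ∧ ∀ b, b ≠ a → rank a ≤ rank b → f (v b) = 0) :
    LinearIndependent 𝕜 v := by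
  classical
  rw [linearIndependent_iff']
  intro s g hg
  by_contra! hs
  obtain ⟨i, hi, hgi⟩ := hs
  -- For an index of least rank in the relation, the functional sees no other term.
  obtain ⟨a, ha, hmin⟩ := (s.filter fun i => g i ≠ 0).exists_min_image rank
    ⟨i, Finset.mem_filter.2 ⟨hi, hgi⟩⟩
  obtain ⟨has, hga⟩ := Finset.mem_filter.1 ha
  obtain ⟨f, hf, hf0⟩ := h a
  have h1 := congrArg f hg
  rw [map_sum, map_zero, Finset.sum_eq_single a, map_smul] at h1
  · exact (smul_ne_zero hga hf) h1
  · intro b hb hba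
    rw [map_smul]
    by_cases hgb : g b = 0
    · rw [hgb, zero_smul]
    · rw [hf0 b hba (hmin b (Finset.mem_filter.2 ⟨hb, hgb⟩)), smul_zero]
  · intro h
    exact absurd has h

variable (𝕜) in
/-- The product of the `1 / (1 - x_i / x_j)` along a list of pairs `(i, j)`. -/
def wordFun (w : List (Fin n × Fin n)) : RatFun 𝕜 n :=
  (w.map fun e => (1 - x 𝕜 e.1 / x 𝕜 e.2)⁻¹).prod

theorem IsForestWord.sublist {v w : List (Fin n × Fin n)} (h : IsForestWord w)
    (hvw : v.Sublist w) : IsForestWord v :=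
  ⟨h.sorted.sublist hvw, fun e he => h.ne e (hvw.subset he),
    fun e he f hf => h.nearly_increasing e (hvw.subset he) f (hvw.subset hf)⟩

theorem wordFun_mem_typeA {w : List (Fin n × Fin n)} (h : ∀ e ∈ w, e.1 ≠ e.2) :
    wordFun 𝕜 w ∈ typeA 𝕜 n := by
  have : wordFun 𝕜 w ∈ typeAOn 𝕜 (Set.univ : Set (Fin n)) := by
    refine list_prod_mem (S := typeAOn 𝕜 Set.univ) fun F hF => ?_
    obtain ⟨e, he, rfl⟩ := List.mem_map.1 hF
    exact typeAOn_inv (Set.mem_univ _) (Set.mem_univ _) (h e he)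
  exact typeAOn_le_typeA this

theorem wordFun_mem_freeOf {w : List (Fin n × Fin n)} {i : Fin n}
    (h : ∀ e ∈ w, e.1 ≠ i ∧ e.2 ≠ i) : wordFun 𝕜 w ∈ freeOf 𝕜 i := by
  refine list_prod_mem (S := freeOf 𝕜 i) fun F hF => ?_
  obtain ⟨e, he, rfl⟩ := List.mem_map.1 hF
  exact inv_mem (sub_mem (one_mem _)
    (div_mem (x_mem_freeOf (h e he).1) (x_mem_freeOf (h e he).2)))

/-- Forest words with the same sources are dual to the products of the `1 / (1 - x_i / x_j)`. -/
theorem wordProd_wordFun {v w : List (Fin n × Fin n)} (hv : IsForestWord v) (hw : IsForestWord w)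
    (hvw : v.map Prod.fst = w.map Prod.fst) {F G : typeA 𝕜 n}
    (hG : ∀ e ∈ w, (G : RatFun 𝕜 n) ∈ freeOf 𝕜 e.1)
    (hF : (F : RatFun 𝕜 n) = wordFun 𝕜 w * G) :
    wordProd 𝕜 v F = if v = w then G else 0 := by
  induction w using List.reverseRecOn generalizing v F with
  | nil =>
    obtain rfl : v = [] := by simpa using hvw
    rw [if_pos rfl]
    exact Subtype.ext (by simpa [wordFun] using hF)
  | append_singleton w e ih =>
    induction v using List.reverseRecOn with
    | nil => simp at hvw
    | append_singleton v f _ =>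
      rw [List.map_append, List.map_append, List.map_singleton, List.map_singleton] at hvw
      obtain ⟨hvw, hfe⟩ := List.append_inj' hvw rfl
      have hfe : f.1 = e.1 := by simpa using hfe
      have hlt : ∀ g ∈ w, g.1 < e.1 := fun g hg =>
        (List.pairwise_append.1 hw.sorted).2.2 g hg e (by simp)
      -- The last edge `e` has the largest source, so an edge `g` into `e.1` would violate near
      -- increase. Hence `x_{e.1}` occurs in the last factor only, and the first operator to act
      -- just compares targets.
      have hfree : wordFun 𝕜 w ∈ freeOf 𝕜 e.1 := wordFun_mem_freeOf fun g hg =>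
        ⟨(hlt g hg).ne, fun h => absurd (hw.nearly_increasing g (by simp [hg]) e (by simp) h)
          (by rw [h]; exact (hlt g hg).asymm)⟩
      have hne : e.1 ≠ e.2 := hw.ne e (by simp)
      have hne' : e.1 ≠ f.2 := hfe ▸ hv.ne f (by simp)
      have hws := hw.sublist (List.sublist_append_left w [e])
      have hvs := hv.sublist (List.sublist_append_left v [f])
      have h1 := (IsConstantTerm.inv_pow (𝕜 := 𝕜) (j := f.2) hne.symm 0).mul
        (mul_mem hfree (hG e (by simp)))
      have h2 : (F : RatFun 𝕜 n) =
          wordFun 𝕜 w * G * (1 - x 𝕜 e.1 / x 𝕜 e.2)⁻¹ ^ (0 + 1) := by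
        rw [hF]
        simp [wordFun]
        ring
      rw [← h2] at h1
      have h3 := h1.ct_eq hne'
      rw [← coe_bracket hne'] at h3
      rw [wordProd_append, Module.End.mul_apply, wordProd_cons, wordProd_nil, mul_one, hfe]
      by_cases h : f.2 = e.2
      · have hfe' : f = e := Prod.ext hfe h
        rw [if_pos h, mul_one] at h3
        rw [ih hvs hws hvw (fun g hg => hG g (by simp [hg])) h3, hfe']
        simp
      · rw [if_neg h, mul_zero] at h3
        have h4 : bracket 𝕜 e.1 f.2 F = 0 := Subtype.ext h3
        rw [h4, map_zero, if_neg]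
        intro h5
        have := (List.append_inj' h5 rfl).2
        simp only [List.cons.injEq, and_true] at this
        exact h (congrArg Prod.snd this)

theorem IsForestWord.eq_of_perm {v w : List (Fin n × Fin n)} (hv : IsForestWord v)
    (hw : IsForestWord w) (h : (v.map Prod.fst).Perm (w.map Prod.fst)) :
    v.map Prod.fst = w.map Prod.fst :=
  h.eq_of_pairwise (le := (· < ·)) (fun _ _ _ _ h h' => absurd h' h.asymm)
    (List.pairwise_map.2 hv.sorted) (List.pairwise_map.2 hw.sorted)

theorem exists_not_source {w : List (Fin n × Fin n)} (h : w.length < n) :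
    ∃ r : Fin n, ∀ e ∈ w, e.1 ≠ r := by
  by_contra! h2
  have h3 : (Finset.univ : Finset (Fin n)) ⊆ (w.map Prod.fst).toFinset := fun a _ => by
    obtain ⟨e, he, rfl⟩ := h2 a
    simp only [List.mem_toFinset, List.mem_map]
    exact ⟨e, he, rfl⟩
  have h4 := Finset.card_le_card h3
  have h5 := (w.map Prod.fst).toFinset_card_le
  simp at h4 h5
  omega

/-- The functional is `T ↦ q T F`, where `q` is a star: it sends every nonsource of `w` other than
`r` to `r`, and `F` is the product of the functions dual to `w` and to `q`. If `v` has the sources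
of `w`, then duality decides. Otherwise `v` removes some `x_a` with `a` not a source of `w`, and `q`
needs `x_a`. -/
theorem exists_dual_functional (hn : 1 ≤ n) {w : List (Fin n × Fin n)} (hw : IsBasicWord w) :
    ∃ f : Module.End 𝕜 (typeA 𝕜 n) →ₗ[𝕜] typeA 𝕜 n, f (wordProd 𝕜 w) ≠ 0 ∧
      ∀ v : List (Fin n × Fin n), IsBasicWord v → v ≠ w → w.length ≤ v.length →
        f (wordProd 𝕜 v) = 0 := by
  obtain ⟨r, hr⟩ := exists_not_source (hw.length_lt hn)
  let L : List (Fin n) := (List.finRange n).filter fun a => a ≠ r ∧ ∀ e ∈ w, e.1 ≠ a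
  have hL : ∀ a, a ∈ L ↔ a ≠ r ∧ ∀ e ∈ w, e.1 ≠ a := fun a => by simp [L]
  let q : List (Fin n × Fin n) := L.map fun a => (a, r)
  have hq : IsForestWord q := by
    refine ⟨List.pairwise_map.2 ((List.pairwise_lt_finRange n).filter _), ?_, ?_⟩
    · intro e he
      obtain ⟨a, ha, rfl⟩ := List.mem_map.1 he
      exact ((hL a).1 ha).1
    · intro e he f hf hef
      obtain ⟨a, ha, rfl⟩ := List.mem_map.1 he
      obtain ⟨b, hb, rfl⟩ := List.mem_map.1 hf
      exact absurd hef.symm ((hL b).1 hb).1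
  have hqw : ∀ e ∈ w, wordFun 𝕜 q ∈ freeOf 𝕜 e.1 := by
    intro e he
    refine wordFun_mem_freeOf fun f hf => ?_
    obtain ⟨a, ha, rfl⟩ := List.mem_map.1 hf
    exact ⟨fun h => ((hL a).1 ha).2 e he h.symm, fun h => hr e he h.symm⟩
  let U : typeA 𝕜 n := ⟨1, typeA_of_laurent laurentZero_one⟩
  let G : typeA 𝕜 n := ⟨wordFun 𝕜 q, wordFun_mem_typeA hq.ne⟩
  let F : typeA 𝕜 n := ⟨wordFun 𝕜 w * wordFun 𝕜 q, typeA_mul (wordFun_mem_typeA hw.ne) G.2⟩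
  have hQ : wordProd 𝕜 q G = U := by
    rw [wordProd_wordFun hq hq rfl (G := U) (fun _ _ => one_mem (freeOf 𝕜 _)) (mul_one _).symm,
      if_pos rfl]
  refine ⟨(LinearMap.applyₗ F).comp (LinearMap.mulLeft 𝕜 (wordProd 𝕜 q)), ?_, ?_⟩
  · show wordProd 𝕜 q (wordProd 𝕜 w F) ≠ 0
    rw [wordProd_wordFun hw.toIsForestWord hw.toIsForestWord rfl (G := G) hqw rfl, if_pos rfl, hQ]
    intro h
    exact one_ne_zero (congrArg Subtype.val h)
  · intro v hv hvw hlen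
    show wordProd 𝕜 q (wordProd 𝕜 v F) = 0
    by_cases hsub : v.map Prod.fst ⊆ w.map Prod.fst
    · have hperm := (hv.nodup_sources.subperm hsub).perm_of_length_le (by simpa using hlen)
      rw [wordProd_wordFun hv.toIsForestWord hw.toIsForestWord
        (hv.eq_of_perm hw.toIsForestWord hperm) (G := G) hqw rfl, if_neg hvw, map_zero]
    · obtain ⟨e, he, hew⟩ : ∃ e ∈ v, ∀ f ∈ w, f.1 ≠ e.1 := by
        by_contra! h
        refine hsub fun a ha => ?_
        obtain ⟨e, he, rfl⟩ := List.mem_map.1 ha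
        obtain ⟨f, hf, hfe⟩ := h e he
        exact List.mem_map.2 ⟨f, hf, hfe⟩
      have hmem := wordProd_mem_typeAOn v (mem_typeAOn_univ F.2)
      obtain ⟨f, hf, hfe⟩ : ∃ f ∈ q, f.1 = e.1 ∨ f.2 = e.1 := by
        by_cases her : e.1 = r
        -- For `e.1 = r` the star must have an edge. If it had none, then `w` and `v` would both
        -- have length `n - 1`. As `r` is a source of the basic word `v`, it is not `0`; so `0`
        -- would be a source of `w`, contrary to `w` being basic.
        · obtain ⟨a, ha⟩ : ∃ a, a ∈ L := by
            by_contra! hLe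
            have hall : ∀ a, a ≠ r → ∃ e ∈ w, e.1 = a := fun a har => by
              have := hLe a
              rw [hL] at this
              push Not at this
              exact this har
            have hlen' : n ≤ w.length + 1 := by
              have h3 : (Finset.univ : Finset (Fin n)) ⊆ (r :: w.map Prod.fst).toFinset := by
                intro a _
                by_cases har : a = r
                · simp [har]
                · obtain ⟨e, he, rfl⟩ := hall a har
                  rw [List.mem_toFinset]
                  exact List.mem_cons_of_mem _ (List.mem_map.2 ⟨e, he, rfl⟩)
              have h4 := Finset.card_le_card h3
              have h5 := (r :: w.map Prod.fst).toFinset_card_le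
              simp at h4 h5
              omega
            have h1 := hw.length_lt hn
            have h2 := hv.length_lt hn
            have h3 := hv.pos_of_length (by omega) e he
            obtain ⟨f, hf, hf0⟩ := hall ⟨0, hn⟩ fun h => h3 (by rw [her, ← h])
            exact hw.pos_of_length (by omega) f hf (by rw [hf0])
          exact ⟨(a, r), List.mem_map.2 ⟨a, ha, rfl⟩, Or.inr her.symm⟩
        · exact ⟨(e.1, r), List.mem_map.2 ⟨e.1, (hL _).2 ⟨her, hew⟩, rfl⟩, Or.inl rfl⟩
      refine wordProd_apply_eq_zero hmem hf ?_
      rcases hfe with h | h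
      · left
        rw [h]
        exact fun h => h.2 ⟨e, he, rfl⟩
      · right
        rw [h]
        exact fun h => h.2 ⟨e, he, rfl⟩

theorem linearIndependent_wordProd (hn : 1 ≤ n) :
    LinearIndependent 𝕜 (fun w : {w : List (Fin n × Fin n) // IsBasicWord w} =>
      wordProd 𝕜 w.1) := by
  refine linearIndependent_of_rank (𝕜 := 𝕜) (V := Module.End 𝕜 (typeA 𝕜 n)) (W := typeA 𝕜 n)
    (fun w : {w : List (Fin n × Fin n) // IsBasicWord w} => wordProd 𝕜 w.1)
    (fun w => w.1.length) fun w => ?_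
  obtain ⟨f, hf, hf0⟩ := exists_dual_functional (𝕜 := 𝕜) hn w.2
  exact ⟨f, hf, fun v hvw hlen => hf0 v.1 v.2 (fun h => hvw (Subtype.ext h)) hlen⟩

end Independence

/-! ### Forests and their edge lists -/

/-- The edge `e` may precede the edge `f` in a reading of an augmented forest from the roots. -/
def Precedes {n : ℕ} (e f : Fin n × Fin n) : Prop :=
  e.1 ≠ f.1 ∧ f.1 ≠ e.2 ∧ (e.2 = f.2 → e.1 < f.1)

/-- The product along a list of edges does not depend on the reading order. -/
theorem wordProd_eq_of_perm {𝕜 : Type*} [Field 𝕜] {n : ℕ} {v w : List (Fin n × Fin n)}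
    (h : v.Perm w) (hv : v.Pairwise Precedes) (hw : w.Pairwise Precedes) :
    wordProd 𝕜 v = wordProd 𝕜 w := by
  induction v generalizing w with
  | nil => rw [List.nil_perm.1 h]
  | cons e v ih =>
    obtain ⟨a, b, rfl⟩ := List.append_of_mem (h.subset (List.mem_cons_self (a := e) (l := v)))
    have hab : v.Perm (a ++ b) := (List.perm_cons e).1 (h.trans List.perm_middle)
    have hv' := List.pairwise_cons.1 hv
    have hw' := List.pairwise_append.1 hw
    -- Each `f` in `a` follows `e` in one reading and precedes it in the other. The two conditions
    -- together make all the indices involved disjoint, so `bracket_comm` applies.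
    have hcomm : Commute (bracket 𝕜 e.1 e.2) (wordProd 𝕜 a) := by
      refine Commute.list_prod_right _ _ fun T hT => ?_
      obtain ⟨f, hf, rfl⟩ := List.mem_map.1 hT
      have h1 := hv'.1 f (hab.symm.subset (List.mem_append_left _ hf))
      have h2 := hw'.2.2 f hf e List.mem_cons_self
      refine bracket_comm h1.1 h2.2.1 (Ne.symm h1.2.1) fun h => ?_
      exact absurd (h1.2.2 h) (h2.2.2 h.symm).asymm
    rw [wordProd_cons, ih hab hv'.2 (hw.sublist (List.Sublist.append_left
      (List.sublist_cons_self _ _) _)), wordProd_append, wordProd_append, wordProd_cons,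
      ← mul_assoc, ← mul_assoc, hcomm.eq]

theorem IsForestWord.pairwise_precedes {n : ℕ} {w : List (Fin n × Fin n)} (h : IsForestWord w) :
    w.Pairwise Precedes := by
  refine h.sorted.imp_of_mem fun {e f} he hf hef => ⟨hef.ne, fun hfe => ?_, fun _ => hef⟩
  have := h.nearly_increasing e he f hf hfe.symm
  rw [← hfe] at this
  exact absurd this hef.asymm

namespace OrderedForest

variable {n : ℕ} (D : OrderedForest n) {r r' u v : Fin n} {k k' : ℕ}

theorem ne_of_mem_children (h : u ∈ D.children v) : u ≠ v := by
  rintro rfl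
  exact D.acyclic u (Relation.TransGen.single h)

theorem mem_level_succ : u ∈ D.level r (k + 1) ↔ ∃ v ∈ D.level r k, u ∈ D.children v := by
  simp [level]

theorem mem_level_zero : u ∈ D.level r 0 ↔ u = r := by simp [level]

theorem level_unique (hr : D.IsRoot r) (hr' : D.IsRoot r') (h : v ∈ D.level r k)
    (h' : v ∈ D.level r' k') : r = r' ∧ k = k' := by
  induction k generalizing v k' with
  | zero =>
    rw [mem_level_zero] at h
    subst h
    cases k' with
    | zero => exact ⟨D.mem_level_zero.1 h', rfl⟩
    | succ k' =>
      obtain ⟨w, -, hw⟩ := D.mem_level_succ.1 h'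
      exact absurd hw (hr w)
  | succ k ih =>
    obtain ⟨w, hwl, hw⟩ := D.mem_level_succ.1 h
    cases k' with
    | zero =>
      rw [mem_level_zero] at h'
      subst h'
      exact absurd hw (hr' w)
    | succ k' =>
      obtain ⟨w', hwl', hw'⟩ := D.mem_level_succ.1 h'
      obtain rfl := D.parent_unique _ _ _ hw hw'
      obtain ⟨h1, h2⟩ := ih hwl hwl'
      exact ⟨h1, by rw [h2]⟩

theorem exists_mem_level (v : Fin n) : ∃ r k, D.IsRoot r ∧ v ∈ D.level r k := by
  -- `R a b` says that `a` is a proper ancestor of `b`.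
  let R : Fin n → Fin n → Prop := fun a b =>
    Relation.TransGen (fun u w => u ∈ D.children w) b a
  have : IsTrans (Fin n) R := ⟨fun a b c h h' => h'.trans h⟩
  have : Std.Irrefl R := ⟨D.acyclic⟩
  have hwf : WellFounded R := Finite.wellFounded_of_trans_of_irrefl R
  induction v using hwf.induction with
  | _ v ih =>
    by_cases hv : D.IsRoot v
    · exact ⟨v, 0, hv, D.mem_level_zero.2 rfl⟩
    · unfold IsRoot at hv
      push Not at hv
      obtain ⟨w, hw⟩ := hv
      obtain ⟨r, k, hr, hk⟩ := ih w (Relation.TransGen.single hw)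
      exact ⟨r, k + 1, hr, D.mem_level_succ.2 ⟨w, hk, hw⟩⟩

/-- Levels `0` to `k` contain `k + 1` distinct vertices. Hence the first `n` levels, which
`edgeWord` reads, cover all edges. -/
theorem level_lt (hr : D.IsRoot r) (h : v ∈ D.level r k) : k < n := by
  have hex : ∀ m ≤ k, ∃ u, u ∈ D.level r m := by
    intro m hm
    induction hm using Nat.decreasingInduction with
    | self => exact ⟨v, h⟩
    | of_succ m _ ih =>
      obtain ⟨u, hu⟩ := ih
      obtain ⟨w, hw, -⟩ := D.mem_level_succ.1 hu
      exact ⟨w, hw⟩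
  choose f hf using fun m : Fin (k + 1) => hex m (Nat.lt_succ_iff.1 m.2)
  have hinj : Function.Injective f := fun a b hab =>
    Fin.ext (D.level_unique hr hr (hf a) (hab ▸ hf b)).2
  simpa using Fintype.card_le_of_injective f hinj

theorem nodup_level (r : Fin n) (k : ℕ) : (D.level r k).Nodup := by
  induction k with
  | zero => simp [level]
  | succ k ih =>
    refine List.nodup_flatMap.2 ⟨fun v _ => D.nodup_children v, ?_⟩
    refine ih.imp fun {a b} hab u hu hu' => hab ?_
    exact D.parent_unique u a b hu hu'

/-- The edges of a forest, tree by tree. -/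
def edges : List (Fin n × Fin n) := ((List.finRange n).filter D.IsRoot).flatMap D.edgeWord

theorem realization_eq (𝕜 : Type*) [Field 𝕜] : D.realization 𝕜 = wordProd 𝕜 D.edges := by
  unfold realization edges
  generalize (List.finRange n).filter D.IsRoot = l
  induction l with
  | nil => rfl
  | cons r l ih =>
    rw [List.map_cons, List.prod_cons, List.flatMap_cons, wordProd_append, ih]
    rfl

theorem mem_edges (e : Fin n × Fin n) : e ∈ D.edges ↔ e.1 ∈ D.children e.2 := by
  constructor
  · intro h
    simp only [edges, edgeWord, List.mem_flatMap, List.mem_map] at h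
    obtain ⟨r, -, k, -, v, -, u, hu, rfl⟩ := h
    exact hu
  · intro h
    obtain ⟨r, k, hr, hk⟩ := D.exists_mem_level e.2
    simp only [edges, edgeWord, List.mem_flatMap, List.mem_map]
    exact ⟨r, by simpa using hr, k, List.mem_range.2 (D.level_lt hr hk), e.2, hk, e.1, h, rfl⟩

/-- The condition `k ≠ k' + 1` within one tree excludes that `b` is the parent of `v`, the only case
in which the edge `(a, b)` has to be read earlier. -/
theorem precedes_of_mem_level (hr : D.IsRoot r) (hr' : D.IsRoot r') {a b : Fin n}
    (hv : v ∈ D.level r k) (hb : b ∈ D.level r' k') (hu : u ∈ D.children v)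
    (ha : a ∈ D.children b) (hvb : v ≠ b) (h : r = r' → k ≠ k' + 1) : Precedes (u, v) (a, b) := by
  refine ⟨fun hua => ?_, fun hav => ?_, fun h => absurd h hvb⟩
  · obtain rfl : u = a := hua
    exact hvb (D.parent_unique u v b hu ha)
  · obtain rfl : a = v := hav
    have := D.level_unique hr hr' hv (D.mem_level_succ.2 ⟨b, hb, ha⟩)
    exact h this.1 this.2

theorem pairwise_precedes_edges (hD : D.IsAugmented) : D.edges.Pairwise Precedes := by
  have hroot : ∀ r ∈ (List.finRange n).filter D.IsRoot, D.IsRoot r := fun r hr => by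
    simpa using hr
  refine List.pairwise_flatMap.2 ⟨fun r hr => ?_, ?_⟩
  · have hr := hroot r hr
    refine List.pairwise_flatMap.2 ⟨fun k _ => ?_, ?_⟩
    · refine List.pairwise_flatMap.2 ⟨fun v hv => ?_, ?_⟩
      · refine List.pairwise_map.2 ((hD v).imp_of_mem fun {a b} ha hb hab => ?_)
        exact ⟨hab.ne, D.ne_of_mem_children hb, fun _ => hab⟩
      · refine (D.nodup_level r k).imp_of_mem fun {a b} ha hb hab e he f hf => ?_
        obtain ⟨u, hu, rfl⟩ := List.mem_map.1 he
        obtain ⟨v, hv, rfl⟩ := List.mem_map.1 hf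
        exact D.precedes_of_mem_level hr hr ha hb hu hv hab (fun _ => by omega)
    · refine List.pairwise_lt_range.imp fun {k l} hkl e he f hf => ?_
      simp only [List.mem_flatMap, List.mem_map] at he hf
      obtain ⟨a, ha, u, hu, rfl⟩ := he
      obtain ⟨b, hb, v, hv, rfl⟩ := hf
      refine D.precedes_of_mem_level hr hr ha hb hu hv ?_ (fun _ => by omega)
      rintro rfl
      exact hkl.ne (D.level_unique hr hr ha hb).2
  · refine ((List.nodup_finRange n).filter _).imp_of_mem fun {r s} hr hs hrs e he f hf => ?_
    have hr := hroot r hr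
    have hs := hroot s hs
    simp only [edgeWord, List.mem_flatMap, List.mem_map] at he hf
    obtain ⟨k, -, a, ha, u, hu, rfl⟩ := he
    obtain ⟨l, -, b, hb, v, hv, rfl⟩ := hf
    refine D.precedes_of_mem_level hr hs ha hb hu hv ?_ (fun h => absurd h hrs)
    rintro rfl
    exact hrs (D.level_unique hr hs ha hb).1

/-- Adjacent vertices have the same root, and each root is connected to everything below it. -/
theorem card_connectedComponent :
    Nat.card D.graph.ConnectedComponent = Nat.card {v // D.IsRoot v} := by
  symm
  choose root depth hroot hlevel using D.exists_mem_level
  have hchild : ∀ u v, u ∈ D.children v → root u = root v := fun u v h =>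
    (D.level_unique (hroot u) (hroot v) (hlevel u) (D.mem_level_succ.2 ⟨v, hlevel v, h⟩)).1
  have hadj : ∀ u v, D.graph.Adj u v → root u = root v := fun u v h => by
    rcases ((SimpleGraph.fromRel_adj _ _ _).1 h).2 with h | h
    · exact hchild u v h
    · exact (hchild v u h).symm
  have hreach : ∀ u v, D.graph.Reachable u v → root u = root v := by
    rintro u v ⟨p⟩
    induction p with
    | nil => rfl
    | cons h _ ih => exact (hadj _ _ h).trans ih
  have hself : ∀ r, D.IsRoot r → root r = r := fun r hr =>
    (D.level_unique (hroot r) hr (hlevel r) (D.mem_level_zero.2 rfl)).1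
  have hdown : ∀ r k v, v ∈ D.level r k → D.graph.Reachable r v := by
    intro r k
    induction k with
    | zero =>
      intro v hv
      rw [D.mem_level_zero.1 hv]
    | succ k ih =>
      intro v hv
      obtain ⟨w, hw, hvw⟩ := D.mem_level_succ.1 hv
      refine (ih w hw).trans (SimpleGraph.Adj.reachable ?_)
      exact (SimpleGraph.fromRel_adj _ _ _).2 ⟨(D.ne_of_mem_children hvw).symm, Or.inr hvw⟩
  refine Nat.card_congr (Equiv.ofBijective
    (fun r : {v // D.IsRoot v} => D.graph.connectedComponentMk r.1) ⟨?_, ?_⟩)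
  · intro r s h
    have := hreach _ _ (SimpleGraph.ConnectedComponent.exact h)
    rw [hself _ r.2, hself _ s.2] at this
    exact Subtype.ext this
  · intro c
    induction c using SimpleGraph.ConnectedComponent.ind with
    | h v =>
      exact ⟨⟨root v, hroot v⟩, SimpleGraph.ConnectedComponent.sound (hdown _ _ _ (hlevel v))⟩

theorem numComponents_add_length (hD : D.IsAugmented) :
    D.numComponents + D.edges.length = n := by
  have hnd : (D.edges.map Prod.fst).Nodup :=
    List.pairwise_map.2 ((D.pairwise_precedes_edges hD).imp fun h => h.1)
  have h1 : (D.edges.map Prod.fst).toFinset = Finset.univ.filter fun v => ¬ D.IsRoot v := by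
    ext v
    simp only [List.mem_toFinset, List.mem_map, Finset.mem_filter, Finset.mem_univ, true_and,
      IsRoot, not_forall, not_not]
    constructor
    · rintro ⟨e, he, rfl⟩
      exact ⟨e.2, (D.mem_edges e).1 he⟩
    · rintro ⟨w, hw⟩
      exact ⟨(v, w), (D.mem_edges _).2 hw, rfl⟩
  have h2 := List.toFinset_card_of_nodup hnd
  rw [h1, List.length_map] at h2
  rw [numComponents, card_connectedComponent, ← h2, Nat.card_eq_fintype_card,
    Fintype.card_subtype, Finset.card_filter_add_card_filter_not, Finset.card_univ,
    Fintype.card_fin]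

theorem exists_isForestWord (hD : D.IsAugmented) (hD' : D.IsNearlyIncreasing) :
    ∃ w, w.Perm D.edges ∧ IsForestWord w := by
  let w := D.edges.mergeSort fun e f => decide (e.1 ≤ f.1)
  have hw : w.Perm D.edges := List.mergeSort_perm _ _
  have hmem : ∀ e ∈ w, e.1 ∈ D.children e.2 := fun e he => (D.mem_edges e).1 (hw.subset he)
  have h1 : w.Pairwise fun e f => e.1 ≤ f.1 := by
    have := List.pairwise_mergeSort (le := fun e f : Fin n × Fin n => decide (e.1 ≤ f.1))
      (fun a b c h h' => by simp only [decide_eq_true_eq] at *; exact h.trans h')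
      (fun a b => by simpa using le_total _ _) D.edges
    exact this.imp fun h => by simpa using h
  have h2 : w.Pairwise fun e f => e.1 ≠ f.1 :=
    (hw.pairwise_iff fun h => Ne.symm h).2 ((D.pairwise_precedes_edges hD).imp fun h => h.1)
  refine ⟨w, hw, (h1.and h2).imp fun h => lt_of_le_of_ne h.1 h.2,
    fun e he => D.ne_of_mem_children (hmem e he), fun e he f hf hef => ?_⟩
  exact hD' e.1 e.2 (hmem e he) fun h => h f.2 (hef ▸ hmem f hf)

/-- The augmented forest with a given list of edges. -/
def ofWord (w : List (Fin n × Fin n)) (hw : IsForestWord w) : OrderedForest n where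
  children v := (w.filter fun e => e.2 = v).map Prod.fst
  nodup_children v := hw.nodup_sources.sublist (List.Sublist.map _ List.filter_sublist)
  parent_unique u v v' h h' := by
    simp only [List.mem_map, List.mem_filter, decide_eq_true_eq] at h h'
    obtain ⟨e, ⟨he, rfl⟩, hu⟩ := h
    obtain ⟨f, ⟨hf, rfl⟩, hu'⟩ := h'
    rw [List.inj_on_of_nodup_map hw.nodup_sources he hf (hu.trans hu'.symm)]
  acyclic v h := by
    -- Labels decrease along a chain of edges as long as its end has a parent. On a cycle every
    -- vertex has one, so that `v < v`.
    have key : ∀ u v', Relation.TransGen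
        (fun u v => u ∈ (w.filter fun e => e.2 = v).map Prod.fst) u v' →
        (∃ f ∈ w, f.1 = u) ∧ ((∃ f ∈ w, f.1 = v') → v' < u) := by
      intro u v' h
      induction h with
      | single h =>
        simp only [List.mem_map, List.mem_filter, decide_eq_true_eq] at h
        obtain ⟨e, ⟨he, rfl⟩, rfl⟩ := h
        exact ⟨⟨e, he, rfl⟩, fun ⟨f, hf, hfe⟩ => hw.nearly_increasing e he f hf hfe.symm⟩
      | tail _ h ih =>
        simp only [List.mem_map, List.mem_filter, decide_eq_true_eq] at h
        obtain ⟨e, ⟨he, rfl⟩, rfl⟩ := h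
        refine ⟨ih.1, fun ⟨f, hf, hfe⟩ => ?_⟩
        exact (hw.nearly_increasing e he f hf hfe.symm).trans (ih.2 ⟨e, he, rfl⟩)
    obtain ⟨h1, h2⟩ := key v v h
    exact lt_irrefl _ (h2 h1)

/-! ### From words back to forests -/

variable {w : List (Fin n × Fin n)} (hw : IsForestWord w)

theorem mem_children_ofWord : u ∈ (ofWord w hw).children v ↔ (u, v) ∈ w := by
  simp [ofWord]

theorem isAugmented_ofWord : (ofWord w hw).IsAugmented := fun _ =>
  List.pairwise_map.2 (hw.sorted.sublist List.filter_sublist)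

theorem isNearlyIncreasing_ofWord : (ofWord w hw).IsNearlyIncreasing := by
  intro u v huv hv
  unfold IsRoot at hv
  push Not at hv
  obtain ⟨z, hz⟩ := hv
  exact hw.nearly_increasing (u, v) ((mem_children_ofWord hw).1 huv) (v, z)
    ((mem_children_ofWord hw).1 hz) rfl

theorem edges_ofWord_perm : (ofWord w hw).edges.Perm w := by
  refine (List.perm_ext_iff_of_nodup ?_ ?_).2 fun e => ?_
  · refine ((ofWord w hw).pairwise_precedes_edges (isAugmented_ofWord hw)).imp ?_
    rintro e f h rfl
    exact h.1 rfl
  · exact hw.nodup_sources.of_map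
  · rw [mem_edges, mem_children_ofWord]

theorem realization_ofWord (𝕜 : Type*) [Field 𝕜] :
    (ofWord w hw).realization 𝕜 = wordProd 𝕜 w := by
  rw [realization_eq]
  exact wordProd_eq_of_perm (edges_ofWord_perm hw)
    ((ofWord w hw).pairwise_precedes_edges (isAugmented_ofWord hw)) hw.pairwise_precedes

theorem exists_wordProd_eq_realization (𝕜 : Type*) [Field 𝕜] (hD : D.IsAugmented)
    (hD' : D.IsNearlyIncreasing) : ∃ w, w.Perm D.edges ∧ IsForestWord w ∧
      D.numComponents + w.length = n ∧ D.realization 𝕜 = wordProd 𝕜 w := by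
  obtain ⟨w, hw, hw'⟩ := D.exists_isForestWord hD hD'
  refine ⟨w, hw, hw', ?_, ?_⟩
  · rw [hw.length_eq, D.numComponents_add_length hD]
  · rw [realization_eq]
    exact wordProd_eq_of_perm hw.symm (D.pairwise_precedes_edges hD) hw'.pairwise_precedes

theorem numComponents_ofWord : (ofWord w hw).numComponents + w.length = n := by
  rw [← (edges_ofWord_perm hw).length_eq, numComponents_add_length _ (isAugmented_ofWord hw)]

/-- With `n - 1` edges there is a single root. It is `0`, because `0` is not a source; so edges into
the root also decrease the label. -/
theorem isIncreasing_ofWord (hb : IsBasicWord w) (hl : w.length + 1 = n) :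
    (ofWord w hw).IsIncreasing := by
  intro u v huv
  by_cases hv : (ofWord w hw).IsRoot v
  swap
  · exact isNearlyIncreasing_ofWord hw u v huv hv
  have huv := (mem_children_ofWord hw).1 huv
  have hu := hb.pos_of_length hl _ huv
  have hvs : v ∉ w.map Prod.fst := by
    intro h
    obtain ⟨e, he, rfl⟩ := List.mem_map.1 h
    exact hv e.2 ((mem_children_ofWord hw).2 he)
  suffices (v : ℕ) = 0 from Fin.lt_def.2 (by simp only at hu; omega)
  by_contra hv0
  have hn : 0 < n := by omega
  have hnd : (v :: ⟨0, hn⟩ :: w.map Prod.fst).Nodup := by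
    refine List.nodup_cons.2 ⟨?_, List.nodup_cons.2 ⟨?_, hw.nodup_sources⟩⟩
    · rw [List.mem_cons, not_or]
      exact ⟨fun h => hv0 (by rw [h]), hvs⟩
    · intro h
      obtain ⟨e, he, he0⟩ := List.mem_map.1 h
      exact hb.pos_of_length hl e he (by rw [he0])
  have := hnd.length_le_card
  simp at this
  omega

end OrderedForest

/-- A forest with `n - s` components has `s` edges. For `s = n - 1` an increasing tree has no edge
out of `0`, which is the extra condition on basic words. -/
theorem basisPart_eq (𝕜 : Type*) [Field 𝕜] {n : ℕ} (s : Fin n) :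
    basisPart 𝕜 n s = {T | ∃ w : List (Fin n × Fin n),
      IsBasicWord w ∧ w.length = s ∧ T = wordProd 𝕜 w} := by
  ext T
  unfold basisPart
  split_ifs with h0 h1
  · simp only [Set.mem_singleton_iff, Set.mem_ofPred_eq, h0, List.length_eq_zero_iff]
    constructor
    · rintro rfl
      exact ⟨[], ⟨⟨by simp, by simp, by simp⟩, by simp⟩, rfl, rfl⟩
    · rintro ⟨w, -, rfl, rfl⟩
      rfl
  · constructor
    · rintro ⟨D, hD, hI, hc, rfl⟩
      obtain ⟨w, hw, hw', hl, e⟩ := D.exists_wordProd_eq_realization 𝕜 hD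
        fun u v huv _ => hI u v huv
      refine ⟨w, ⟨hw', fun _ e he h => ?_⟩, by omega, e⟩
      have := Fin.lt_def.1 (hI _ _ ((D.mem_edges e).1 (hw.subset he)))
      omega
    · rintro ⟨w, hw, hl, rfl⟩
      have hc := OrderedForest.numComponents_ofWord hw.toIsForestWord
      exact ⟨.ofWord w hw.toIsForestWord, OrderedForest.isAugmented_ofWord _,
        OrderedForest.isIncreasing_ofWord _ hw (by omega), by omega,
        (OrderedForest.realization_ofWord _ 𝕜).symm⟩
  · constructor
    · rintro ⟨D, hD, hI, hc, rfl⟩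
      obtain ⟨w, hw, hw', hl, e⟩ := D.exists_wordProd_eq_realization 𝕜 hD hI
      exact ⟨w, ⟨hw', fun h => absurd h (by omega)⟩, by omega, e⟩
    · rintro ⟨w, hw, hl, rfl⟩
      have hc := OrderedForest.numComponents_ofWord hw.toIsForestWord
      exact ⟨.ofWord w hw.toIsForestWord, OrderedForest.isAugmented_ofWord _,
        OrderedForest.isNearlyIncreasing_ofWord _, by omega,
        (OrderedForest.realization_ofWord _ 𝕜).symm⟩

theorem iUnion_basisPart (𝕜 : Type*) [Field 𝕜] {n : ℕ} (hn : 1 ≤ n) :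
    (⋃ s : Fin n, basisPart 𝕜 n s) =
      {T | ∃ w : List (Fin n × Fin n), IsBasicWord w ∧ T = wordProd 𝕜 w} := by
  ext T
  simp only [Set.mem_iUnion, basisPart_eq, Set.mem_ofPred_eq]
  constructor
  · rintro ⟨_, w, hw, -, rfl⟩
    exact ⟨w, hw, rfl⟩
  · rintro ⟨w, hw, rfl⟩
    exact ⟨⟨w.length, hw.length_lt hn⟩, w, hw, rfl, rfl⟩

end ConstantTermAlgebra

end

theorem theorem3p15 (𝕜 : Type*) [Field 𝕜] (n : ℕ) (hn : 1 ≤ n) :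
    LinearIndepOn 𝕜 id (⋃ s : Fin n, ConstantTermAlgebra.basisPart 𝕜 n s) ∧
      Submodule.span 𝕜 (⋃ s : Fin n, ConstantTermAlgebra.basisPart 𝕜 n s) =
        Subalgebra.toSubmodule (ConstantTermAlgebra.constantTermAlgebra 𝕜 n) := by
  rw [ConstantTermAlgebra.iUnion_basisPart 𝕜 hn]
  refine ⟨?_, ConstantTermAlgebra.span_isBasicWord⟩
  have h := (ConstantTermAlgebra.linearIndependent_wordProd (𝕜 := 𝕜) hn).linearIndepOn_id
  refine h.mono ?_
  rintro _ ⟨w, hw, rfl⟩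
  exact ⟨⟨w, hw⟩, rfl⟩
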